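/- Let $n\ge 1$ and let $\Lambda(n)$ be the Grassmannian of Lagrangian subspaces of $\mathbb R^{2n}$ with coordinates $(x,\xi)$. For $I\sqcup J=\{1,\dots,n\}$ put $\hat y_{I,J}=(\hat x_I,\hat\xi_J)$, and for a real symmetric matrix $a$ let $L_{I,J}(a)\in\Lambda(n)$ be the subspace $$\xi_I=a_{II}x_I+a_{IJ}\xi_J,\qquad x_J=-a_{JI}x_I-a_{JJ}\xi_J .$$ The maps $a\mapsto L_{I,J}(a)$ parametrize charts $U_{I,J}$ that cover $\Lambda(n)$ and define its topology. Let $V=\widehat{\mathbb C}[[\hat y,\hbar]]((e^{c/i\hbar}\mid c\in\mathbb C))$ be the space of sums $\sum_c e^{c/i\hbar}v_c$ in which, for each real $R$, only finitely many $c$ with $\operatorname{Re}c\le R$ occur, and each $v_c=\sum_{k\ge N(c)}v_{c,k}$ is a formal sum of elements $v_{c,k}\in\mathbb C[\hat y,\hbar,\hbar^{-1}]$ homogeneous of degree $k$ for the grading $|\hat y_i|=1$, $|\hbar|=2$. Put $\mathcal H^{\hat y_{I,J}}=\bigoplus_a \exp\!\big(\tfrac{a\hat y_{I,J}^2}{2i\hbar}\big)V$,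 and let $\mathcal H$ be the quotient of $\bigoplus_{I,J}\mathcal H^{\hat y_{I,J}}$ by the relations that identify $\exp(\frac{a\hat y^2}{2i\hbar})f(\hat y)\in\mathcal H^{\hat y_{I,J}}$ with its partial Fourier transform in the variables $\hat y_A$, for every $A\subset\{1,\dots,n\}$ with $\det a_{AA}\ne0$. With $B$ the complement of $A$, this transform is $$\frac{e^{-\pi i|A|/2}(-1)^{p(a_{AA})}}{\sqrt{|\det a_{AA}|}}\;f\Big(\hat y_B,\,i\hbar\frac{\partial}{\partial\hat\eta_A}\Big)\exp\!\Big(\frac{a_{BB}\hat y_B^2-a_{AA}^{-1}(\hat\eta_A+a_{AB}\hat y_B)^2}{2i\hbar}\Big)\in\mathcal H^{\hat y_{I',J'}},$$ where $p$ is the number of positive eigenvalues, $I'$ is the symmetric difference of $I$ and $A$, $J'$ is its complement, and $\hat\eta_j=-\hat\xi_j$ for $j\in A\cap I$, $\hat\eta_j=\hat x_j$ for $j\in A\cap J$. Let $\mathcal H_L\subset\mathcal H$ be the span of the classes of all $\exp(\frac{a\hat y_{I,J}^2}{2i\hbar})f$ with $L_{I,J}(a)=L$, and let $\mathbf 1_{I,J}(a)\in\mathcal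 H_{L_{I,J}(a)}$ be the class of $\exp(\frac{a\hat y_{I,J}^2}{2i\hbar})\cdot 1$. Then: 1. For all $(I,J)$ and $a$ the map $V\to\mathcal H_{L_{I,J}(a)}$, $f\mapsto[\exp(\frac{a\hat y_{I,J}^2}{2i\hbar})f]$, is a linear isomorphism, and it maps $\mathbb C\cdot1$ onto a line $\ell_L$ that depends only on $L=L_{I,J}(a)$: the lines $\mathbb C\cdot\mathbf 1_{I,J}$ agree on overlaps of charts, and in the trivialization of $\mathcal H$ over $U_{I,J}$ they form the constant subspace $\mathbb C\cdot 1\subset V$. 2. Give the total space $\ell=\bigsqcup_L\ell_L$ the topology in which a set is open if and only if all its preimages under the maps $(a,z)\mapsto z\,\mathbf 1_{I,J}(a)$ are open. Then $\ell$ is a topological complex line bundle over $\Lambda(n)$, and over each chart $U_{I,J}$ it has a local trivialization with $\mathbf 1_{I,J}\mapsto 1$. 3. The Čech cohomology group $H^1(\Lambda(n),\mathbb Z)$ is infinite cyclic. Let $\mu$ be any Čech cocycle, on any open cover, whose class generates this group (the Maslov class, up to sign). Then $\ell$ is isomorphic, as a complex line bundle over $\Lambda(n)$, to the line bundle with the locally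 constant transition functions $(-1)^{\mu}$. The isomorphism can be chosen so that in the local frames of the latter bundle the phase $s/|s|$ of each section $s=\mathbf 1_{I,J}$ is locally constant, so that $(-1)^\mu$ is the class of the phases of the transition functions of $\ell$. -/

import Mathlib

open scoped LaurentPolynomial Topology
open Bundle

noncomputable section

namespace WeilBundle

/-! ## The Lagrangian Grassmannian -/

/-- The standard symplectic form on `ℝ²ⁿ`, whose points are pairs `(x, ξ)`. -/
def sympl {n : ℕ} (v w : (Fin n → ℝ) × (Fin n → ℝ)) : ℝ := v.2 ⬝ᵥ w.1 - v.1 ⬝ᵥ w.2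

/-- `Λ(n)`: the linear subspaces of `ℝ²ⁿ` that are equal to their own symplectic complement. -/
def Lag (n : ℕ) : Type :=
  {L : Submodule ℝ ((Fin n → ℝ) × (Fin n → ℝ)) // ∀ v, v ∈ L ↔ ∀ w ∈ L, sympl v w = 0}

/-- Real symmetric `n × n` matrices, with the topology of a space of matrices. -/
abbrev SymMat (n : ℕ) : Type := {a : Matrix (Fin n) (Fin n) ℝ // a.IsSymm}

/-- The coordinates `ŷ_{I,J} = (x_I, ξ_J)` of a point, where `J` is the complement of `I`. -/
def pos {n : ℕ} (I : Finset (Fin n)) :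
    ((Fin n → ℝ) × (Fin n → ℝ)) →ₗ[ℝ] (Fin n → ℝ) where
  toFun v i := if i ∈ I then v.1 i else v.2 i
  map_add' v w := by ext i; dsimp; split_ifs <;> rfl
  map_smul' r v := by ext i; dsimp; split_ifs <;> rfl

/-- The complementary coordinates `(ξ_I, -x_J)`. -/
def mom {n : ℕ} (I : Finset (Fin n)) :
    ((Fin n → ℝ) × (Fin n → ℝ)) →ₗ[ℝ] (Fin n → ℝ) where
  toFun v i := if i ∈ I then v.2 i else -v.1 i
  map_add' v w := by ext i; dsimp; split_ifs <;> ring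
  map_smul' r v := by ext i; dsimp; split_ifs <;> ring

theorem sympl_eq {n : ℕ} (I : Finset (Fin n)) (v w : (Fin n → ℝ) × (Fin n → ℝ)) :
    sympl v w = mom I v ⬝ᵥ pos I w - pos I v ⬝ᵥ mom I w := by
  simp only [sympl, dotProduct, ← Finset.sum_sub_distrib]
  refine Finset.sum_congr rfl fun i _ => ?_
  by_cases h : i ∈ I <;> simp [pos, mom, h]
  ring

theorem exists_pos_mom {n : ℕ} (I : Finset (Fin n)) (y u : Fin n → ℝ) :
    ∃ v, pos I v = y ∧ mom I v = u := by
  refine ⟨(fun i => if i ∈ I then y i else -u i, fun i => if i ∈ I then u i else y i), ?_, ?_⟩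
  · ext i; by_cases h : i ∈ I <;> simp [pos, h]
  · ext i; by_cases h : i ∈ I <;> simp [mom, h]

/-- The subspace `ξ_I = a_{II} x_I + a_{IJ} ξ_J`, `x_J = - a_{JI} x_I - a_{JJ} ξ_J`. -/
def graph {n : ℕ} (I : Finset (Fin n)) (a : SymMat n) :
    Submodule ℝ ((Fin n → ℝ) × (Fin n → ℝ)) :=
  LinearMap.eqLocus (mom I) (Matrix.mulVecLin a.1 ∘ₗ pos I)

theorem mem_graph {n : ℕ} {I : Finset (Fin n)} {a : SymMat n} {v} :
    v ∈ graph I a ↔ mom I v = a.1.mulVec (pos I v) := Iff.rfl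

theorem graph_lagrangian {n : ℕ} (I : Finset (Fin n)) (a : SymMat n)
    (v : (Fin n → ℝ) × (Fin n → ℝ)) :
    v ∈ graph I a ↔ ∀ w ∈ graph I a, sympl v w = 0 := by
  have key : ∀ y z : Fin n → ℝ, y ⬝ᵥ a.1.mulVec z = a.1.mulVec y ⬝ᵥ z := fun y z => by
    rw [Matrix.dotProduct_mulVec, ← Matrix.mulVec_transpose, a.2.eq]
  constructor
  · intro hv w hw
    rw [sympl_eq I, mem_graph.1 hv, mem_graph.1 hw, key, sub_self]
  · intro h
    rw [mem_graph, ← sub_eq_zero]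
    obtain ⟨w, hw1, hw2⟩ := exists_pos_mom I (mom I v - a.1.mulVec (pos I v))
      (a.1.mulVec (mom I v - a.1.mulVec (pos I v)))
    have := h w (by rw [mem_graph, hw1, hw2])
    rw [sympl_eq I, hw1, hw2, key, ← sub_dotProduct] at this
    exact dotProduct_self_eq_zero.1 this

/-- The parametrization of the chart `U_{I,J}` of `Λ(n)` by symmetric matrices. -/
def chart {n : ℕ} (I : Finset (Fin n)) (a : SymMat n) : Lag n :=
  ⟨graph I a, graph_lagrangian I a⟩

/-- The topology of `Λ(n)`: a set is open when its preimage in every chart is open. -/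
instance (n : ℕ) : TopologicalSpace (Lag n) :=
  ⨆ I : Finset (Fin n), TopologicalSpace.coinduced (chart I) inferInstance

/-! ## The coefficient space `Ĉ[[ŷ, ħ]]((e^{c/iħ} | c ∈ ℂ))` -/

/-- Polynomials in `ŷ₁, …, ŷₙ` over `ℂ[ħ, ħ⁻¹]`. The Laurent variable `T` is `ħ`. -/
abbrev Poly (n : ℕ) : Type := MvPolynomial (Fin n) ℂ[T;T⁻¹]

/-- The elements of degree `k` for the grading `|ŷᵢ| = 1`, `|ħ| = 2`. -/
def homog (n : ℕ) (k : ℤ) : Submodule ℂ (Poly n) :=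
  Submodule.span ℂ {p | ∃ (α : Fin n →₀ ℕ) (j : ℤ),
    (α.degree : ℤ) + 2 * j = k ∧ p = MvPolynomial.monomial α (LaurentPolynomial.T j)}

/-- The space of all sums `∑ e^{c/iħ} v_c`, where each `v_c = ∑_{k ≥ N(c)} v_{c,k}` is a formal sum
of homogeneous components `v_{c,k}` of degree `k`, and where for every real `R` only finitely many
`c` with `Re c ≤ R` occur. The element is stored as the family `v c k = v_{c,k}`. -/
def Coef (n : ℕ) : Submodule ℂ (ℂ → ℤ → Poly n) where
  carrier := {v | (∀ c k, v c k ∈ homog n k) ∧ (∀ c, ∃ N : ℤ, ∀ k < N, v c k = 0) ∧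
    ∀ R : ℝ, {c : ℂ | v c ≠ 0 ∧ c.re ≤ R}.Finite}
  add_mem' := by
    rintro v w ⟨hv1, hv2, hv3⟩ ⟨hw1, hw2, hw3⟩
    refine ⟨fun c k => add_mem (hv1 c k) (hw1 c k), fun c => ?_, fun R => ?_⟩
    · obtain ⟨N, hN⟩ := hv2 c
      obtain ⟨M, hM⟩ := hw2 c
      refine ⟨min N M, fun k hk => ?_⟩
      simp [hN k (lt_of_lt_of_le hk (min_le_left _ _)),
        hM k (lt_of_lt_of_le hk (min_le_right _ _))]
    · refine ((hv3 R).union (hw3 R)).subset ?_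
      rintro c ⟨hc, hR⟩
      by_cases h : v c = 0
      · refine Or.inr ⟨fun h' => hc ?_, hR⟩
        simp [h, h']
      · exact Or.inl ⟨h, hR⟩
  zero_mem' := ⟨fun c k => zero_mem _, fun c => ⟨0, fun k _ => rfl⟩, fun R => by simp⟩
  smul_mem' := by
    rintro r v ⟨hv1, hv2, hv3⟩
    refine ⟨fun c k => Submodule.smul_mem _ r (hv1 c k), fun c => ?_, fun R => ?_⟩
    · obtain ⟨N, hN⟩ := hv2 c
      exact ⟨N, fun k hk => by simp [hN k hk]⟩
    · refine (hv3 R).subset ?_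
      rintro c ⟨hc, hR⟩
      exact ⟨fun h => hc (by simp [h]), hR⟩

instance (n : ℕ) : AddCommGroup (Coef n) := Submodule.addCommGroup (Coef n)

theorem one_mem_homog (n : ℕ) : (1 : Poly n) ∈ homog n 0 :=
  Submodule.subset_span ⟨0, 0, by simp, by simp [MvPolynomial.monomial_zero']⟩

/-- The element `1` of the coefficient space. -/
def Coef.one (n : ℕ) : Coef n :=
  ⟨Pi.single 0 (Pi.single 0 1), by
    refine ⟨fun c k => ?_, fun c => ⟨0, fun k hk => ?_⟩, fun R => ?_⟩
    · by_cases hc : c = 0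
      · subst hc
        by_cases hk : k = 0
        · subst hk
          simpa using one_mem_homog n
        · simp [hk]
      · simp [hc]
    · by_cases hc : c = 0
      · subst hc
        simp [hk.ne]
      · simp [hc]
    · refine (Set.finite_singleton (0 : ℂ)).subset ?_
      rintro c ⟨hc, -⟩
      by_contra h
      exact hc (by simp [show c ≠ 0 from h])⟩

/-! ## Partial Fourier transforms -/

/-- The block `a_{AA}`. -/
def block {n : ℕ} (A : Finset (Fin n)) (a : SymMat n) : Matrix A A ℝ :=
  a.1.submatrix Subtype.val Subtype.val

theorem block_symm {n : ℕ} (A : Finset (Fin n)) (a : SymMat n) : (block A a).IsSymm :=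
  a.2.submatrix _

theorem block_herm {n : ℕ} (A : Finset (Fin n)) (a : SymMat n) : (block A a).IsHermitian := by
  rw [Matrix.IsHermitian, Matrix.conjTranspose_eq_transpose_of_trivial]
  exact block_symm A a

/-- The number of positive eigenvalues of `a_{AA}`, with multiplicity. -/
def numPos {n : ℕ} (A : Finset (Fin n)) (a : SymMat n) : ℕ :=
  (Finset.univ.filter fun i => 0 < (block_herm A a).eigenvalues i).card

/-- The scalar `e^{-πi|A|/2} (-1)^{p(a_{AA})} / √|det a_{AA}|` of the Fourier transform in the
variables `ŷ_A`. -/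
def fourierConst {n : ℕ} (A : Finset (Fin n)) (a : SymMat n) : ℂ :=
  Complex.exp (-(Real.pi * Complex.I * A.card / 2)) * (-1) ^ numPos A a /
    (Real.sqrt |(block A a).det| : ℂ)

/-- The sign relating the Fourier dual variable `η_j` of `ŷ_j` to the new coordinate:
`η_j = -ξ_j` if `ŷ_j = x_j`, and `η_j = x_j` if `ŷ_j = ξ_j`. -/
def dualSign {n : ℕ} (I : Finset (Fin n)) (j : Fin n) : ℝ := if j ∈ I then -1 else 1

/-- The inverse of the block `a_{AA}`, extended by zero. -/
def blockInv {n : ℕ} (A : Finset (Fin n)) (a : SymMat n) : Matrix (Fin n) (Fin n) ℝ :=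
  fun i j => if h : i ∈ A ∧ j ∈ A then (block A a)⁻¹ ⟨i, h.1⟩ ⟨j, h.2⟩ else 0

/-- The rows in `A` give the linear forms `(η_A + a_{AB} ŷ_B)_i` in the new coordinates, where
`B` is the complement of `A`. The other rows are zero. -/
def shiftMat {n : ℕ} (I A : Finset (Fin n)) (a : SymMat n) : Matrix (Fin n) (Fin n) ℝ :=
  fun i j => if i ∈ A then
    (if j ∈ A then (if i = j then dualSign I j else 0) else a.1 i j) else 0

/-- The block `a_{BB}`, extended by zero, where `B` is the complement of `A`. -/
def restBlock {n : ℕ} (A : Finset (Fin n)) (a : SymMat n) : Matrix (Fin n) (Fin n) ℝ :=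
  fun i j => if i ∈ A ∨ j ∈ A then 0 else a.1 i j

/-- The matrix of the quadratic form
`a_{BB} ŷ_B² - a_{AA}⁻¹ (η_A + a_{AB} ŷ_B)²` in the new coordinates. -/
def fourierForm {n : ℕ} (I A : Finset (Fin n)) (a : SymMat n) : SymMat n :=
  ⟨restBlock A a - (shiftMat I A a).transpose * blockInv A a * shiftMat I A a, by
    have h1 : (restBlock A a).transpose = restBlock A a := by
      ext i j
      simp only [restBlock, Matrix.transpose_apply, or_comm, a.2.apply i j]
    have h2 : (blockInv A a).transpose = blockInv A a := by
      ext i j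
      have hs : ((block A a)⁻¹).transpose = (block A a)⁻¹ := by
        rw [Matrix.transpose_nonsing_inv, (block_symm A a).eq]
      by_cases h : i ∈ A ∧ j ∈ A
      · simp only [blockInv, Matrix.transpose_apply, h, and_self, dite_true]
        exact congrFun (congrFun hs ⟨i, h.1⟩) ⟨j, h.2⟩
      · have h' : ¬ (j ∈ A ∧ i ∈ A) := fun h' => h h'.symm
        simp only [blockInv, Matrix.transpose_apply, h, h', dite_false]
    rw [Matrix.IsSymm, Matrix.transpose_sub, Matrix.transpose_mul, Matrix.transpose_mul,
      Matrix.transpose_transpose, h1, h2, Matrix.mul_assoc]⟩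

/-- The operator on polynomials in the new coordinates that replaces `ŷ_j`: multiplication by the
`j`-th coordinate if `j ∉ A`, and `exp(-S'/2iħ) ∘ iħ ∂/∂η_j ∘ exp(S'/2iħ)`, which is equal to
`iħ ∂/∂η_j - (a_{AA}⁻¹ (η_A + a_{AB} ŷ_B))_j`, if `j ∈ A`. Here `S'` is the quadratic form
`fourierForm I A a`. -/
def dualOp {n : ℕ} (I A : Finset (Fin n)) (a : SymMat n) (j : Fin n) :
    Module.End ℂ[T;T⁻¹] (Poly n) :=
  if j ∈ A then
    (LaurentPolynomial.C (Complex.I * (dualSign I j : ℂ)) * LaurentPolynomial.T 1) •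
        (MvPolynomial.pderiv j).toLinearMap -
      LinearMap.mulLeft ℂ[T;T⁻¹] (∑ k, MvPolynomial.C (LaurentPolynomial.C
        (((blockInv A a * shiftMat I A a) j k : ℝ) : ℂ)) * MvPolynomial.X k)
  else LinearMap.mulLeft ℂ[T;T⁻¹] (MvPolynomial.X j)

/-- The map `f ↦ f(ŷ_B, exp(-S'/2iħ) ∘ iħ ∂/∂η_A ∘ exp(S'/2iħ)) 1` on polynomials. -/
def dualSubst {n : ℕ} (I A : Finset (Fin n)) (a : SymMat n) :
    Poly n →ₗ[ℂ[T;T⁻¹]] Poly n :=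
  (MvPolynomial.basisMonomials (Fin n) ℂ[T;T⁻¹]).constr ℂ[T;T⁻¹]
    fun α => (List.ofFn fun j => dualOp I A a j ^ α j).prod 1

theorem T_smul_mem {n : ℕ} {k : ℤ} (j : ℤ) {p : Poly n} (hp : p ∈ homog n k) :
    (LaurentPolynomial.T j : ℂ[T;T⁻¹]) • p ∈ homog n (k + 2 * j) := by
  induction hp using Submodule.span_induction with
  | mem p hp =>
    obtain ⟨α, i, h, rfl⟩ := hp
    refine Submodule.subset_span ⟨α, j + i, by linarith, ?_⟩
    rw [MvPolynomial.smul_monomial, smul_eq_mul, LaurentPolynomial.T_add]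
  | zero => simp
  | add p q _ _ hp hq => rw [smul_add]; exact add_mem hp hq
  | smul r p _ hp => rw [smul_comm]; exact Submodule.smul_mem _ _ hp

theorem X_mul_mem {n : ℕ} {k : ℤ} (j : Fin n) {p : Poly n} (hp : p ∈ homog n k) :
    MvPolynomial.X j * p ∈ homog n (k + 1) := by
  induction hp using Submodule.span_induction with
  | mem p hp =>
    obtain ⟨α, i, h, rfl⟩ := hp
    refine Submodule.subset_span ⟨Finsupp.single j 1 + α, i, ?_, ?_⟩
    · rw [map_add, Finsupp.degree_single]; push_cast; linarith
    · rw [MvPolynomial.X, MvPolynomial.monomial_mul, one_mul]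
  | zero => simp
  | add p q _ _ hp hq => rw [mul_add]; exact add_mem hp hq
  | smul r p _ hp => rw [mul_smul_comm]; exact Submodule.smul_mem _ _ hp

theorem pderiv_mem {n : ℕ} {k : ℤ} (j : Fin n) {p : Poly n} (hp : p ∈ homog n k) :
    MvPolynomial.pderiv j p ∈ homog n (k - 1) := by
  induction hp using Submodule.span_induction with
  | mem p hp =>
    obtain ⟨α, i, h, rfl⟩ := hp
    rw [MvPolynomial.pderiv_monomial]
    by_cases h0 : α j = 0
    · simp [h0]
    · have hle : Finsupp.single j 1 ≤ α := by
        rw [Finsupp.single_le_iff]; omega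
      have hdeg : α.degree = (α - Finsupp.single j 1).degree + 1 := by
        conv_lhs => rw [← tsub_add_cancel_of_le hle]
        rw [map_add, Finsupp.degree_single]
      have : MvPolynomial.monomial (α - Finsupp.single j 1)
          ((LaurentPolynomial.T i : ℂ[T;T⁻¹]) * (α j : ℂ[T;T⁻¹])) =
          (α j : ℂ) • MvPolynomial.monomial (α - Finsupp.single j 1)
            (LaurentPolynomial.T i : ℂ[T;T⁻¹]) := by
        rw [MvPolynomial.smul_monomial, Algebra.smul_def, map_natCast, mul_comm]
      rw [this]
      refine Submodule.smul_mem _ _ (Submodule.subset_span ⟨_, i, ?_, rfl⟩)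
      rw [hdeg] at h; push_cast at h; linarith
  | zero => simp
  | add p q _ _ hp hq => rw [map_add]; exact add_mem hp hq
  | smul r p _ hp =>
    rw [← algebraMap_smul ℂ[T;T⁻¹] r p, Derivation.map_smul, algebraMap_smul]
    exact Submodule.smul_mem _ _ hp

theorem C_smul {n : ℕ} (r : ℂ) (p : Poly n) :
    (LaurentPolynomial.C r : ℂ[T;T⁻¹]) • p = r • p :=
  algebraMap_smul ℂ[T;T⁻¹] r p

theorem dualOp_mem {n : ℕ} (I A : Finset (Fin n)) (a : SymMat n) (j : Fin n) {k : ℤ} {p : Poly n}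
    (hp : p ∈ homog n k) : dualOp I A a j p ∈ homog n (k + 1) := by
  unfold dualOp
  split_ifs
  · rw [LinearMap.sub_apply]
    refine sub_mem ?_ ?_
    · rw [LinearMap.smul_apply, mul_smul, C_smul]
      have := T_smul_mem 1 (pderiv_mem j hp)
      rw [show k - 1 + 2 * 1 = k + 1 by ring] at this
      exact Submodule.smul_mem _ _ this
    · rw [LinearMap.mulLeft_apply, Finset.sum_mul]
      refine sum_mem fun i _ => ?_
      rw [mul_assoc, ← MvPolynomial.smul_eq_C_mul, C_smul]
      exact Submodule.smul_mem _ _ (X_mul_mem i hp)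
  · exact X_mul_mem j hp

theorem dualOp_pow_mem {n : ℕ} (I A : Finset (Fin n)) (a : SymMat n) (j : Fin n) (m : ℕ) {k : ℤ}
    {p : Poly n} (hp : p ∈ homog n k) : (dualOp I A a j ^ m) p ∈ homog n (k + m) := by
  induction m with
  | zero => simpa using hp
  | succ m ih =>
    rw [pow_succ', Module.End.mul_apply, Nat.cast_succ, ← add_assoc]
    exact dualOp_mem I A a j ih

theorem dualProd_mem {n : ℕ} (I A : Finset (Fin n)) (a : SymMat n) (α : Fin n →₀ ℕ) :
    (List.ofFn fun j => dualOp I A a j ^ α j).prod 1 ∈ homog n α.degree := by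
  have key : ∀ l : List (Fin n),
      (l.map fun j => dualOp I A a j ^ α j).prod 1 ∈ homog n ((l.map α).sum : ℕ) := by
    intro l
    induction l with
    | nil => simpa using one_mem_homog n
    | cons j l ih =>
      rw [List.map_cons, List.map_cons, List.prod_cons, Module.End.mul_apply, List.sum_cons,
        Nat.cast_add, add_comm]
      exact dualOp_pow_mem I A a j _ ih
  have h := key (List.finRange n)
  rw [← List.ofFn_eq_map, ← List.ofFn_eq_map, List.sum_ofFn] at h
  rwa [Finsupp.degree_eq_sum]

theorem dualSubst_mem {n : ℕ} (I A : Finset (Fin n)) (a : SymMat n) {k : ℤ} {p : Poly n}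
    (hp : p ∈ homog n k) : dualSubst I A a p ∈ homog n k := by
  induction hp using Submodule.span_induction with
  | mem p hp =>
    obtain ⟨α, i, h, rfl⟩ := hp
    have : (MvPolynomial.monomial α (LaurentPolynomial.T i : ℂ[T;T⁻¹]) : Poly n) =
        (LaurentPolynomial.T i : ℂ[T;T⁻¹]) •
          MvPolynomial.basisMonomials (Fin n) ℂ[T;T⁻¹] α := by
      rw [MvPolynomial.coe_basisMonomials, MvPolynomial.smul_monomial, smul_eq_mul, mul_one]
    rw [this, map_smul, dualSubst, Module.Basis.constr_basis, ← h]
    exact T_smul_mem i (dualProd_mem I A a α)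
  | zero => simp
  | add p q _ _ hp hq => rw [map_add]; exact add_mem hp hq
  | smul r p _ hp =>
    rw [← C_smul, map_smul, C_smul]
    exact Submodule.smul_mem _ _ hp

/-- The partial Fourier transform in the variables `ŷ_A`: it sends
`exp(a ŷ²/2iħ) f` to `exp(a' ŷ'²/2iħ) (fourier I A a f)`, where `a' = fourierForm I A a`
and `ŷ'` are the new coordinates. -/
def fourier {n : ℕ} (I A : Finset (Fin n)) (a : SymMat n) : Coef n →ₗ[ℂ] Coef n where
  toFun f := ⟨fun c k => fourierConst A a • dualSubst I A a (f.1 c k), by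
    obtain ⟨h1, h2, h3⟩ := f.2
    refine ⟨fun c k => Submodule.smul_mem _ _ (dualSubst_mem I A a (h1 c k)), fun c => ?_,
      fun R => ?_⟩
    · obtain ⟨N, hN⟩ := h2 c
      exact ⟨N, fun k hk => by simp [hN k hk]⟩
    · refine (h3 R).subset ?_
      rintro c ⟨hc, hR⟩
      exact ⟨fun h => hc (by ext1 k; simp [h]), hR⟩⟩
  map_add' f g := by
    ext1; funext c k
    simp
  map_smul' r f := by
    ext1; funext c k
    simp only [Submodule.coe_smul, Pi.smul_apply, RingHom.id_apply]
    rw [← C_smul r (f.1 c k), map_smul, C_smul, smul_comm]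

/-! ## The space `ℋ`, its fibers over `Λ(n)` and the lines `ℂ · 1_{I,J}` -/

/-- The free sum of the spaces `ℋ_a^{ŷ_{I,J}} = exp(a ŷ²/2iħ) · Coef n`. -/
abbrev PreWeil (n : ℕ) : Type := (Finset (Fin n) × SymMat n) →₀ Coef n

/-- The relations that identify an element with its partial Fourier transforms. The new set of
`x`-variables is the symmetric difference of `I` and `A`. -/
def weilRel (n : ℕ) : Submodule ℂ (PreWeil n) :=
  Submodule.span ℂ {v | ∃ (I A : Finset (Fin n)) (a : SymMat n) (f : Coef n),
    (block A a).det ≠ 0 ∧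
    v = Finsupp.single (I, a) f -
      Finsupp.single (symmDiff I A, fourierForm I A a) (fourier I A a f)}

/-- The space `ℋ`. -/
abbrev Weil (n : ℕ) : Type := PreWeil n ⧸ weilRel n

/-- The map `f ↦ [exp(a ŷ_{I,J}²/2iħ) f]`. -/
def incl {n : ℕ} (I : Finset (Fin n)) (a : SymMat n) : Coef n →ₗ[ℂ] Weil n :=
  (weilRel n).mkQ ∘ₗ Finsupp.lsingle (I, a)

/-- The fiber of `ℋ` at `L`: all `[exp(a ŷ_{I,J}²/2iħ) f]` whose Lagrangian subspace is `L`. -/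
def fiber {n : ℕ} (L : Lag n) : Submodule ℂ (Weil n) :=
  Submodule.span ℂ {v | ∃ I a f, chart I a = L ∧ v = incl I a f}

/-- The vector `[exp(a ŷ_{I,J}²/2iħ) · 1]`, that is, `1_{I,J}` at the point `a` of the chart. -/
def unitVec {n : ℕ} (I : Finset (Fin n)) (a : SymMat n) : Weil n := incl I a (Coef.one n)

/-- The span of the lines `ℂ · 1_{I,J}` at `L`, for all charts that contain `L`. -/
def lineAt {n : ℕ} (L : Lag n) : Submodule ℂ (Weil n) :=
  Submodule.span ℂ {v | ∃ I a, chart I a = L ∧ v = unitVec I a}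

theorem unitVec_mem {n : ℕ} (I : Finset (Fin n)) (a : SymMat n) :
    unitVec I a ∈ lineAt (chart I a) :=
  Submodule.subset_span ⟨I, a, rfl, rfl⟩

/-- The family of the spaces `lineAt L` over `Λ(n)`. -/
def Line (n : ℕ) (L : Lag n) : Type := lineAt L

instance (n : ℕ) (L : Lag n) : AddCommGroup (Line n L) :=
  inferInstanceAs (AddCommGroup (lineAt L))

instance (n : ℕ) (L : Lag n) : Module ℂ (Line n L) :=
  inferInstanceAs (Module ℂ (lineAt L))

/-- The section `1_{I,J}` over the chart `U_{I,J}`. -/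
def frame {n : ℕ} (I : Finset (Fin n)) (a : SymMat n) : Line n (chart I a) :=
  ⟨unitVec I a, unitVec_mem I a⟩

/-- The map `(a, z) ↦ z · 1_{I,J}(a)` to the total space. -/
def framePar {n : ℕ} (I : Finset (Fin n)) (p : SymMat n × ℂ) : TotalSpace ℂ (Line n) :=
  ⟨chart I p.1, p.2 • frame I p.1⟩

/-- The topology of the total space: a set is open when its preimage under every `framePar I` is
open. -/
instance (n : ℕ) : TopologicalSpace (TotalSpace ℂ (Line n)) :=
  ⨆ I : Finset (Fin n), TopologicalSpace.coinduced (framePar I) inferInstance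

instance (n : ℕ) (L : Lag n) : TopologicalSpace (Line n L) :=
  TopologicalSpace.induced (TotalSpace.mk' ℂ L) inferInstance

/-! ## Čech cohomology in degree one -/

/-- A Čech one-cocycle on an open cover, with values in locally constant functions to `ℤ`. -/
structure Cocycle (X : Type) [TopologicalSpace X] where
  ι : Type
  U : ι → Set X
  isOpen : ∀ i, IsOpen (U i)
  cover : ∀ x, ∃ i, x ∈ U i
  val : ι → ι → X → ℤ
  locConst : ∀ i j, ∀ x ∈ U i ∩ U j, ∀ᶠ y in 𝓝 x, val i j y = val i j x
  cocycle : ∀ i j k, ∀ x ∈ U i ∩ U j ∩ U k, val i j x + val j k x = val i k x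

/-- The multiple `m · μ`. -/
def Cocycle.mul {X : Type} [TopologicalSpace X] (m : ℤ) (μ : Cocycle X) : Cocycle X where
  ι := μ.ι
  U := μ.U
  isOpen := μ.isOpen
  cover := μ.cover
  val i j x := m * μ.val i j x
  locConst i j x hx := (μ.locConst i j x hx).mono fun y hy => by rw [hy]
  cocycle i j k x hx := by rw [← mul_add, μ.cocycle i j k x hx]

/-- Two cocycles define the same class in `H¹(X, ℤ)`: on the common refinement by the sets
`U i ∩ U' k` their difference is the coboundary of a locally constant cochain `b`. -/
def Cocycle.Cohomologous {X : Type} [TopologicalSpace X] (μ ν : Cocycle X) : Prop :=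
  ∃ b : μ.ι → ν.ι → X → ℤ,
    (∀ i k, ∀ x ∈ μ.U i ∩ ν.U k, ∀ᶠ y in 𝓝 x, b i k y = b i k x) ∧
    ∀ i j k l, ∀ x ∈ μ.U i ∩ μ.U j ∩ (ν.U k ∩ ν.U l),
      μ.val i j x - ν.val k l x = b i k x - b j l x

/-- `H¹(X, ℤ)` is infinite cyclic and the class of `μ` is a generator: every class is a unique
integer multiple of the class of `μ`. -/
def Cocycle.IsGenerator {X : Type} [TopologicalSpace X] (μ : Cocycle X) : Prop :=
  ∀ ν : Cocycle X, ∃! m : ℤ, ν.Cohomologous (μ.mul m)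

theorem Cocycle.val_self {X : Type} [TopologicalSpace X] (μ : Cocycle X) (i : μ.ι) (x : X)
    (hx : x ∈ μ.U i) : μ.val i i x = 0 := by
  have := μ.cocycle i i i x ⟨⟨hx, hx⟩, hx⟩
  linarith

/-- The complex line bundle with the locally constant transition functions `(-1)^μ`. -/
def Cocycle.signBundle {X : Type} [TopologicalSpace X] (μ : Cocycle X) :
    VectorBundleCore ℂ X ℂ μ.ι where
  baseSet := μ.U
  isOpen_baseSet := μ.isOpen
  indexAt x := (μ.cover x).choose
  mem_baseSet_at x := (μ.cover x).choose_spec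
  coordChange i j x := ((-1 : ℂ) ^ μ.val i j x) • ContinuousLinearMap.id ℂ ℂ
  coordChange_self i x hx v := by simp [μ.val_self i x hx]
  continuousOn_coordChange i j x hx := by
    refine ContinuousAt.continuousWithinAt ?_
    refine (continuousAt_const (y := ((-1 : ℂ) ^ μ.val i j x) •
      ContinuousLinearMap.id ℂ ℂ)).congr ?_
    filter_upwards [μ.locConst i j x hx] with y hy
    rw [hy]
  coordChange_comp i j k x hx v := by
    rw [← μ.cocycle i j k x hx, zpow_add₀ (by norm_num)]
    simp only [smul_apply, ContinuousLinearMap.id_apply, smul_eq_mul]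
    ring

end WeilBundle

end

open WeilBundle

noncomputable section

namespace WeilBundle

open Matrix

/-! The theorem rests on two independent facts: partial Fourier transforms compose without any
anomaly, and the complex number det(1 + ia) records both their scalars and the Maslov class.

Composition. The transform of exp(aŷ²/2iħ) by `ŷ_A` again has the Lagrangian subspace L(a)
(`chart_fourierForm`), and conversely any two presentations of the same L differ by exactly one
transform (`chart_eq_iff`). Its operator part intertwines the actions of all x̂_j and ξ̂_j and fixes
the vacuum 1. Since 1 is cyclic, such an operator is unique (`Intertwines.unique`), so the operator
parts of two successive transforms compose to that of the direct one, with no Gaussian integrals.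

Scalars. Put D(a) = det(1 + ia), which never vanishes. A change of chart multiplies D by i^|A| det
a_AA up to direction (`maslovDet_eq`), so the Fourier scalar is the quotient of the values of the
`weight` D/|D|^{3/2} at the two presentations (`fourierConst_mul_weight`). The scalars are thus a
coboundary, whence `fourier_fourier`: the relations do not collapse the fibers, and the vectors
1_{I,J}(a)/weight(a) glue to a global frame of ℓ. Hence ℓ is even trivial, and all topological
claims about it reduce to Λ(n) × ℂ.

Maslov class. The charts are copies of the contractible space of symmetric matrices, so every
integer cocycle can be moved to the cover by charts. There it is determined up to coboundary by one
integer: the jump between the components a_jj > 0 and a_jj < 0 of the overlap of two adjacent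
charts, which does not depend on the pair (`IsChartCocycle.jump_eq`,
`IsChartCocycle.exists_primitive`). The continuous argument θ of D, corrected by |I|π/2, differs
between charts by multiples of π; these multiples form a cocycle of jump 1, hence a generator.

Comparison. The function exp(-i·phase) changes between charts by the sign (-1)^μ, so it carries the
global frame of ℓ to the bundle (-1)^μ. In 1_{I,J} = (e^{iθ}/√|D|)·frame the varying angle θ then
cancels and only a locally constant phase is left. -/

/-! ## Changes of charts -/

/-- The point of `L_{I,J}(a)` with coordinates `ŷ_{I,J} = y`. -/
theorem exists_mem_graph {n : ℕ} (I : Finset (Fin n)) (a : SymMat n) (y : Fin n → ℝ) :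
    ∃ v ∈ graph I a, pos I v = y := by
  obtain ⟨v, h1, h2⟩ := exists_pos_mom I y (a.1 *ᵥ y)
  exact ⟨v, by rw [mem_graph, h1, h2], h1⟩

theorem chart_injective {n : ℕ} (I : Finset (Fin n)) : Function.Injective (chart I) := by
  intro a b h
  have h' : graph I a = graph I b := congrArg Subtype.val h
  refine Subtype.ext (Matrix.mulVec_injective (funext fun y => ?_))
  obtain ⟨v, hv, rfl⟩ := exists_mem_graph I a y
  exact (mem_graph.1 hv).symm.trans (mem_graph.1 (h' ▸ hv))

/-- Taking symplectic complements reverses inclusions, and a Lagrangian subspace is its own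
complement. Equalities in `Lag n` therefore need only one inclusion, with no count of dimensions. -/
theorem Lag.eq_of_le {n : ℕ} {L M : Lag n} (h : L.1 ≤ M.1) : L = M := by
  refine Subtype.ext (le_antisymm h fun v hv => ?_)
  rw [L.2]
  exact fun w hw => (M.2 v).1 hv w (h hw)

/-- On `L_{I,J}(a)`, the new coordinates after a Fourier transform in `ŷ_A`, as functions of
`ŷ_{I,J}`. -/
def posMat {n : ℕ} (I A : Finset (Fin n)) (a : SymMat n) : Matrix (Fin n) (Fin n) ℝ :=
  fun i j => if i ∈ A then -dualSign I i * a.1 i j else (1 : Matrix (Fin n) (Fin n) ℝ) i j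

/-- On `L_{I,J}(a)`, the new momenta after a Fourier transform in `ŷ_A`, as functions of
`ŷ_{I,J}`. -/
def momMat {n : ℕ} (I A : Finset (Fin n)) (a : SymMat n) : Matrix (Fin n) (Fin n) ℝ :=
  fun i j => if i ∈ A then dualSign I i * (1 : Matrix (Fin n) (Fin n) ℝ) i j else a.1 i j

theorem sum_eq_sum_mem_add {n : ℕ} (A : Finset (Fin n)) (f : Fin n → ℝ) :
    ∑ j, f j = ∑ j ∈ A, f j + ∑ j, if j ∈ A then 0 else f j := by
  rw [← Finset.sum_filter_add_sum_filter_not Finset.univ (· ∈ A), Finset.filter_mem_eq_inter,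
    Finset.univ_inter, Finset.sum_filter]
  simp only [ite_not]

theorem dualSign_mul_self {n : ℕ} (I : Finset (Fin n)) (j : Fin n) :
    dualSign I j * dualSign I j = 1 := by
  unfold dualSign; split_ifs <;> norm_num

theorem pos_symmDiff {n : ℕ} (I A : Finset (Fin n)) (v : (Fin n → ℝ) × (Fin n → ℝ)) (i : Fin n) :
    pos (symmDiff I A) v i = if i ∈ A then -dualSign I i * mom I v i else pos I v i := by
  by_cases h : i ∈ A <;> by_cases h' : i ∈ I <;>
    simp [pos, mom, dualSign, Finset.mem_symmDiff, h, h']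

theorem mom_symmDiff {n : ℕ} (I A : Finset (Fin n)) (v : (Fin n → ℝ) × (Fin n → ℝ)) (i : Fin n) :
    mom (symmDiff I A) v i = if i ∈ A then dualSign I i * pos I v i else mom I v i := by
  by_cases h : i ∈ A <;> by_cases h' : i ∈ I <;>
    simp [pos, mom, dualSign, Finset.mem_symmDiff, h, h']

theorem pos_eq_posMat {n : ℕ} {I : Finset (Fin n)} (A : Finset (Fin n)) {a : SymMat n}
    {v : (Fin n → ℝ) × (Fin n → ℝ)} (hv : v ∈ graph I a) :
    pos (symmDiff I A) v = posMat I A a *ᵥ pos I v := by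
  ext i
  rw [pos_symmDiff, mem_graph.1 hv]
  by_cases h : i ∈ A
  · simp [posMat, h, mulVec, dotProduct, Finset.mul_sum, mul_assoc]
  · simp [posMat, h, mulVec, dotProduct, one_apply]

theorem mom_eq_momMat {n : ℕ} {I : Finset (Fin n)} (A : Finset (Fin n)) {a : SymMat n}
    {v : (Fin n → ℝ) × (Fin n → ℝ)} (hv : v ∈ graph I a) :
    mom (symmDiff I A) v = momMat I A a *ᵥ pos I v := by
  ext i
  rw [mom_symmDiff, mem_graph.1 hv]
  by_cases h : i ∈ A
  · simp [momMat, h, mulVec, dotProduct, one_apply]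
  · simp [momMat, h, mulVec, dotProduct]

/-- The rows outside A are rows of the identity, so once the signs are factored out the matrix is
block triangular with diagonal blocks a_AA and 1. -/
theorem det_posMat {n : ℕ} (I A : Finset (Fin n)) (a : SymMat n) :
    (posMat I A a).det = (∏ i ∈ A, -dualSign I i) * (block A a).det := by
  have h : posMat I A a = diagonal (fun i => if i ∈ A then -dualSign I i else 1) *
      Matrix.of fun i j => if i ∈ A then a.1 i j else (1 : Matrix (Fin n) (Fin n) ℝ) i j := by
    ext i j
    rw [diagonal_mul]
    by_cases h : i ∈ A <;> simp [posMat, h]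
  rw [h, det_mul, det_diagonal, Finset.prod_ite_mem, Finset.univ_inter]
  congr 1
  rw [twoBlockTriangular_det _ (· ∈ A)]
  · have h1 : (toSquareBlockProp (Matrix.of fun i j => if i ∈ A then a.1 i j else
        (1 : Matrix (Fin n) (Fin n) ℝ) i j) fun i => ¬ i ∈ A) = 1 := by
      ext i j
      simp [toSquareBlockProp_def, i.2, one_apply, Subtype.ext_iff]
    have h2 : (toSquareBlockProp (Matrix.of fun i j => if i ∈ A then a.1 i j else
        (1 : Matrix (Fin n) (Fin n) ℝ) i j) fun i => i ∈ A) =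
        block A a := by
      ext i j
      simp [toSquareBlockProp_def, block]
    rw [h1, h2, det_one, mul_one]
    congr!
  · intro i hi j hj
    have : i ≠ j := fun h => hi (h ▸ hj)
    simp [hi, one_apply, this]

/-- If L lies in both charts, the coordinate changes on L in the two directions are inverse to each
other, so `posMat` is invertible. -/
theorem block_det_ne_zero {n : ℕ} {I A : Finset (Fin n)} {a b : SymMat n}
    (h : chart I a = chart (symmDiff I A) b) : (block A a).det ≠ 0 := by
  have hg : graph I a = graph (symmDiff I A) b := congrArg Subtype.val h
  have : posMat (symmDiff I A) A b * posMat I A a = 1 := by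
    refine Matrix.mulVec_injective (funext fun y => ?_)
    obtain ⟨v, hv, rfl⟩ := exists_mem_graph I a y
    rw [← mulVec_mulVec, ← pos_eq_posMat A hv, ← pos_eq_posMat A (hg ▸ hv),
      symmDiff_symmDiff_cancel_right, one_mulVec]
  have hd := congrArg det this
  rw [det_mul, det_posMat I, det_one] at hd
  exact fun h0 => by simp [h0] at hd

/-- On L the dual variables are minus the momenta, η_A = -(aŷ)_A, so that η_A + a_AB ŷ_B = -a_AA
ŷ_A. This is the stationary point equation of the Fourier integral. -/
theorem shiftMat_mulVec {n : ℕ} {I A : Finset (Fin n)} {a : SymMat n}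
    {v : (Fin n → ℝ) × (Fin n → ℝ)} (hv : v ∈ graph I a) (i : Fin n) :
    (shiftMat I A a *ᵥ pos (symmDiff I A) v) i =
      if i ∈ A then -∑ j ∈ A, a.1 i j * pos I v j else 0 := by
  by_cases h : i ∈ A
  · rw [if_pos h]
    have h1 : mom I v i = ∑ j, a.1 i j * pos I v j := by rw [mem_graph.1 hv]; rfl
    have h2 : ∀ j, shiftMat I A a i j * pos (symmDiff I A) v j =
        (if i = j then -mom I v i else 0) + if j ∈ A then 0 else a.1 i j * pos I v j := by
      intro j
      rw [pos_symmDiff]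
      by_cases hj : j ∈ A
      · by_cases hij : i = j
        · subst hij
          simp only [shiftMat, h, if_true, add_zero]
          rw [← mul_assoc, mul_neg, dualSign_mul_self, neg_one_mul]
        · simp [shiftMat, h, hj, hij]
      · have : i ≠ j := fun h' => hj (h' ▸ h)
        simp [shiftMat, h, hj, this]
    rw [mulVec, dotProduct, Finset.sum_congr rfl fun j _ => h2 j, Finset.sum_add_distrib,
      Finset.sum_ite_eq, if_pos (Finset.mem_univ i), h1, sum_eq_sum_mem_add A]
    ring
  · simp [h, shiftMat, mulVec, dotProduct]

theorem blockInv_mulVec {n : ℕ} {A : Finset (Fin n)} {a : SymMat n} (hA : (block A a).det ≠ 0)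
    {y z : Fin n → ℝ} (h : ∀ i ∈ A, z i = ∑ j ∈ A, a.1 i j * y j) (i : Fin n) :
    (blockInv A a *ᵥ z) i = if i ∈ A then y i else 0 := by
  by_cases hi : i ∈ A
  · rw [if_pos hi]
    have hz : (fun j : A => z j) = block A a *ᵥ fun j : A => y j := by
      ext j
      rw [h j j.2, mulVec, dotProduct, ← Finset.sum_coe_sort]
      rfl
    have : (blockInv A a *ᵥ z) i = ((block A a)⁻¹ *ᵥ fun j : A => z j) ⟨i, hi⟩ := by
      rw [mulVec, mulVec, dotProduct, dotProduct,
        ← Finset.sum_filter_add_sum_filter_not Finset.univ (· ∈ A)]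
      rw [Finset.sum_eq_zero (s := Finset.univ.filter fun x => ¬ x ∈ A), add_zero,
        Finset.filter_mem_eq_inter, Finset.univ_inter, ← Finset.sum_coe_sort]
      · refine Finset.sum_congr rfl fun j _ => ?_
        simp [blockInv, hi]
      · intro j hj
        simp [blockInv, (Finset.mem_filter.1 hj).2]
    rw [this, hz, mulVec_mulVec, nonsing_inv_mul _ (isUnit_iff_ne_zero.2 hA), one_mulVec]
  · simp [hi, blockInv, mulVec, dotProduct]

theorem blockInv_shiftMat_mulVec {n : ℕ} {I A : Finset (Fin n)} {a : SymMat n}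
    (hA : (block A a).det ≠ 0) {v : (Fin n → ℝ) × (Fin n → ℝ)} (hv : v ∈ graph I a) (i : Fin n) :
    ((blockInv A a * shiftMat I A a) *ᵥ pos (symmDiff I A) v) i =
      if i ∈ A then -pos I v i else 0 := by
  rw [← mulVec_mulVec]
  refine blockInv_mulVec hA (y := -pos I v) (fun j hj => ?_) i
  rw [shiftMat_mulVec hv, if_pos hj]
  simp

theorem fourierForm_row_mem {n : ℕ} {I A : Finset (Fin n)} (a : SymMat n) {i : Fin n} (hi : i ∈ A)
    (j : Fin n) :
    (fourierForm I A a).1 i j = -dualSign I i * (blockInv A a * shiftMat I A a) i j := by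
  have h : ∀ k, (shiftMat I A a).transpose i k = if k = i then dualSign I i else 0 := by
    intro k
    by_cases hk : k ∈ A
    · by_cases hki : k = i <;> simp [shiftMat, hk, hi, hki]
    · have : k ≠ i := fun h => hk (h ▸ hi)
      simp [shiftMat, hk, this]
  rw [fourierForm]
  simp only [Matrix.mul_assoc, Matrix.sub_apply, restBlock, hi, true_or, if_true]
  rw [mul_apply, Finset.sum_congr rfl fun k _ => by rw [h k]]
  simp

theorem fourierForm_row_notMem {n : ℕ} {I A : Finset (Fin n)} (a : SymMat n) {i : Fin n}
    (hi : i ∉ A) (j : Fin n) :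
    (fourierForm I A a).1 i j = (if j ∈ A then 0 else a.1 i j) -
      ∑ k ∈ A, a.1 i k * (blockInv A a * shiftMat I A a) k j := by
  have h : ∀ k, (shiftMat I A a).transpose i k = if k ∈ A then a.1 i k else 0 := by
    intro k
    by_cases hk : k ∈ A
    · simp [shiftMat, hk, hi, a.2.apply]
    · simp [shiftMat, hk]
  rw [fourierForm]
  simp only [Matrix.mul_assoc, Matrix.sub_apply, restBlock, hi, false_or]
  rw [mul_apply, Finset.sum_congr rfl fun k _ => by rw [h k]]
  simp

/-- The new quadratic form is a Legendre transform of the old one in the variables `ŷ_A`, so both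
generate the same Lagrangian subspace. -/
theorem chart_fourierForm {n : ℕ} (I A : Finset (Fin n)) (a : SymMat n)
    (hA : (block A a).det ≠ 0) : chart (symmDiff I A) (fourierForm I A a) = chart I a := by
  refine (Lag.eq_of_le fun v hv => ?_).symm
  change v ∈ graph I a at hv
  change v ∈ graph _ _
  have hS := blockInv_shiftMat_mulVec hA hv
  rw [mem_graph]
  ext i
  rw [mom_symmDiff]
  by_cases hi : i ∈ A
  · have : ((fourierForm I A a).1 *ᵥ pos (symmDiff I A) v) i = -dualSign I i *
        ((blockInv A a * shiftMat I A a) *ᵥ pos (symmDiff I A) v) i := by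
      simp only [mulVec, dotProduct, fourierForm_row_mem a hi, Finset.mul_sum, mul_assoc]
    rw [this, hS]
    simp [hi]
  · have : ((fourierForm I A a).1 *ᵥ pos (symmDiff I A) v) i =
        (∑ j, (if j ∈ A then 0 else a.1 i j) * pos (symmDiff I A) v j) - ∑ k ∈ A, a.1 i k *
        ((blockInv A a * shiftMat I A a) *ᵥ pos (symmDiff I A) v) k := by
      simp only [mulVec, dotProduct, fourierForm_row_notMem a hi, sub_mul, Finset.sum_sub_distrib,
        Finset.mul_sum, Finset.sum_mul, mul_assoc]
      rw [Finset.sum_comm]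
    have h2 : ∑ k ∈ A, a.1 i k *
        ((blockInv A a * shiftMat I A a) *ᵥ pos (symmDiff I A) v) k =
        -∑ k ∈ A, a.1 i k * pos I v k := by
      rw [← Finset.sum_neg_distrib]
      refine Finset.sum_congr rfl fun k hk => ?_
      rw [hS, if_pos hk, mul_neg]
    have h3 : ∀ j, (if j ∈ A then 0 else a.1 i j) * pos (symmDiff I A) v j =
        if j ∈ A then 0 else a.1 i j * pos I v j := by
      intro j
      rw [pos_symmDiff]
      by_cases hj : j ∈ A <;> simp [hj]
    rw [this, if_neg hi, mem_graph.1 hv, h2, mulVec, dotProduct, sum_eq_sum_mem_add A,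
      Finset.sum_congr rfl fun j _ => h3 j]
    ring

/-- Every K is the symmetric difference of I with a suitable A, so this describes all coincidences
between charts: presentations of the same L are linked by a single defining relation of `Weil n`. -/
theorem chart_eq_iff {n : ℕ} {I A : Finset (Fin n)} {a b : SymMat n} :
    chart (symmDiff I A) b = chart I a ↔ (block A a).det ≠ 0 ∧ b = fourierForm I A a := by
  refine ⟨fun h => ?_, ?_⟩
  · have hA := block_det_ne_zero h.symm
    exact ⟨hA, chart_injective _ (h.trans (chart_fourierForm I A a hA).symm)⟩
  · rintro ⟨hA, rfl⟩
    exact chart_fourierForm I A a hA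

/-! ## The charts cover `Λ(n)` -/

theorem exists_pos_injective {n : ℕ} (L : Lag n) :
    ∃ I : Finset (Fin n), ∀ v ∈ L.1, pos I v = 0 → v = 0 := by
  classical
  -- I is a minimal set of positions x_I that determine x on L.
  obtain ⟨I, hI, hmin⟩ := Finset.exists_minimal (s := Finset.univ.filter
      fun I : Finset (Fin n) => ∀ v ∈ L.1, (∀ i ∈ I, v.1 i = 0) → v.1 = 0)
    ⟨Finset.univ, by simp [funext_iff]⟩
  simp only [Finset.mem_filter, Finset.mem_univ, true_and] at hI hmin
  refine ⟨I, fun v hv h => ?_⟩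
  have hpos : ∀ i, (if i ∈ I then v.1 i else v.2 i) = 0 := fun i => congrFun h i
  have hx : v.1 = 0 := hI v hv fun i hi => by simpa [hi] using hpos i
  refine Prod.ext hx (funext fun i => ?_)
  by_cases hi : i ∈ I
  -- Without such a w the smaller set I \ {i} would still determine x on L. Pairing v with w then
  -- isolates the coordinate ξ_i of v.
  · have : ∃ w ∈ L.1, (∀ j ∈ I.erase i, w.1 j = 0) ∧ w.1 i ≠ 0 := by
      by_contra hc
      push Not at hc
      have := hmin (y := I.erase i) (fun w hw hw0 => hI w hw fun j hj => ?_) (Finset.erase_subset i I)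
      · exact absurd (this hi) (by simp)
      · by_cases hji : j = i
        · exact hji ▸ hc w hw hw0
        · exact hw0 j (Finset.mem_erase.2 ⟨hji, hj⟩)
    obtain ⟨w, hw, hw0, hwi⟩ := this
    have hs := (L.2 v).1 hv w hw
    rw [sympl, hx, zero_dotProduct, sub_zero, dotProduct, Finset.sum_eq_single i] at hs
    · simpa [hwi] using hs
    · intro j _ hji
      by_cases hj : j ∈ I
      · rw [hw0 j (Finset.mem_erase.2 ⟨hji, hj⟩), mul_zero]
      · have := hpos j
        rw [if_neg hj] at this
        rw [this, zero_mul]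
    · simp
  · simpa [hi] using hpos i

theorem exists_chart {n : ℕ} (L : Lag n) : ∃ I a, chart I a = L := by
  obtain ⟨I, hI⟩ := exists_pos_injective L
  let p : L.1 →ₗ[ℝ] (Fin n → ℝ) := pos I ∘ₗ L.1.subtype
  have hinj : Function.Injective p := by
    rw [← LinearMap.ker_eq_bot, LinearMap.ker_eq_bot']
    exact fun v hv => Subtype.ext (hI v v.2 hv)
  have hsurj : Function.Surjective p := by
    rw [← LinearMap.range_eq_top]
    by_contra hne
    -- If the projection missed a vector, a nonzero functional y would vanish on its image. The
    -- vector with ŷ_I-coordinates 0 and momentum y is then orthogonal to L, hence in L, against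
    -- injectivity.
    obtain ⟨f, hf, hfk⟩ := Submodule.exists_le_ker_of_lt_top _ (lt_top_iff_ne_top.2 hne)
    obtain ⟨y, rfl⟩ := (dotProductEquiv ℝ (Fin n)).surjective f
    obtain ⟨v, hv1, hv2⟩ := exists_pos_mom I 0 y
    have : v ∈ L.1 := (L.2 v).2 fun w hw => by
      rw [sympl_eq I, hv1, hv2, zero_dotProduct, sub_zero]
      exact hfk ⟨⟨w, hw⟩, rfl⟩
    have := hI v this hv1
    rw [this, map_zero] at hv2
    exact hf (by rw [← hv2, map_zero])
  let e := LinearEquiv.ofBijective p ⟨hinj, hsurj⟩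
  let a := LinearMap.toMatrix' (mom I ∘ₗ L.1.subtype ∘ₗ e.symm.toLinearMap)
  have ha : ∀ v ∈ L.1, mom I v = a *ᵥ pos I v := by
    intro v hv
    rw [← toLin'_apply, toLin'_toMatrix']
    have : e.symm (pos I v) = ⟨v, hv⟩ := e.symm_apply_apply ⟨v, hv⟩
    simp [this]
  have hsymm : a.IsSymm := by
    have key : ∀ y z, a *ᵥ y ⬝ᵥ z = y ⬝ᵥ a *ᵥ z := by
      intro y z
      obtain ⟨v, rfl⟩ := hsurj y
      obtain ⟨w, rfl⟩ := hsurj z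
      have := (L.2 v.1).1 v.2 w.1 w.2
      rw [sympl_eq I, ha _ v.2, ha _ w.2, sub_eq_zero] at this
      exact this
    ext i j
    have := key (Pi.single i 1) (Pi.single j 1)
    simpa using this
  exact ⟨I, ⟨a, hsymm⟩, (Lag.eq_of_le fun v hv => mem_graph.2 (ha v hv)).symm⟩

/-! ## The canonical commutation relations -/

/-- The element `iħ`. -/
def iħ : ℂ[T;T⁻¹] := LaurentPolynomial.C Complex.I * LaurentPolynomial.T 1

/-- Real scalars in the ring of polynomials. -/
def ofRealPoly (n : ℕ) : ℝ →+* Poly n :=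
  MvPolynomial.C.comp (LaurentPolynomial.C.comp Complex.ofRealHom)

theorem ofRealPoly_mul {n : ℕ} (r : ℝ) (p : Poly n) :
    ofRealPoly n r * p = (LaurentPolynomial.C (r : ℂ) : ℂ[T;T⁻¹]) • p := by
  rw [MvPolynomial.smul_eq_C_mul]; rfl

theorem pderiv_ofRealPoly {n : ℕ} (j : Fin n) (r : ℝ) :
    MvPolynomial.pderiv j (ofRealPoly n r) = 0 :=
  MvPolynomial.pderiv_C

/-- The linear form with coefficients `r`. -/
def linForm {n : ℕ} (r : Fin n → ℝ) : Poly n := ∑ k, ofRealPoly n (r k) * MvPolynomial.X k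

theorem linForm_neg {n : ℕ} (r : Fin n → ℝ) : linForm (-r) = -linForm r := by
  rw [linForm, linForm, ← Finset.sum_neg_distrib]
  refine Finset.sum_congr rfl fun k _ => ?_
  rw [Pi.neg_apply, map_neg]
  ring

theorem linForm_single {n : ℕ} (j : Fin n) :
    linForm (Pi.single j 1) = (MvPolynomial.X j : Poly n) := by
  rw [linForm, Finset.sum_eq_single j]
  · simp
  · intro k _ hk; simp [hk]
  · simp

theorem linForm_sum {n : ℕ} (c : Fin n → ℝ) (r : Fin n → Fin n → ℝ) :
    linForm (∑ k, c k • r k) = ∑ k, ofRealPoly n (c k) * linForm (r k) := by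
  simp only [linForm, Finset.sum_apply, Pi.smul_apply, smul_eq_mul, map_sum, map_mul,
    Finset.sum_mul, Finset.mul_sum, mul_assoc]
  rw [Finset.sum_comm]

theorem pderiv_linForm {n : ℕ} (j : Fin n) (r : Fin n → ℝ) :
    MvPolynomial.pderiv j (linForm r) = ofRealPoly n (r j) := by
  rw [linForm, map_sum, Finset.sum_eq_single j]
  · rw [Derivation.leibniz, pderiv_ofRealPoly, MvPolynomial.pderiv_X_self]; simp
  · intro k _ hk
    rw [Derivation.leibniz, pderiv_ofRealPoly, MvPolynomial.pderiv_X_of_ne hk]; simp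
  · simp

/-- The operator `exp(-aŷ²/2iħ) ∘ iħ ∂/∂ŷ_j ∘ exp(aŷ²/2iħ)`. -/
def momOp {n : ℕ} (a : SymMat n) (j : Fin n) : Module.End ℂ[T;T⁻¹] (Poly n) :=
  iħ • (MvPolynomial.pderiv j).toLinearMap + LinearMap.mulLeft ℂ[T;T⁻¹] (linForm (a.1 j))

theorem momOp_apply {n : ℕ} (a : SymMat n) (j : Fin n) (p : Poly n) :
    momOp a j p = iħ • MvPolynomial.pderiv j p + linForm (a.1 j) * p := rfl

theorem momOp_X_mul {n : ℕ} (a : SymMat n) (j k : Fin n) (p : Poly n) :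
    momOp a j (MvPolynomial.X k * p) =
      MvPolynomial.X k * momOp a j p + (if j = k then iħ else 0) • p := by
  rw [momOp_apply, momOp_apply, Derivation.leibniz]
  by_cases h : j = k
  · subst h
    simp only [MvPolynomial.pderiv_X_self, smul_eq_mul, MvPolynomial.smul_eq_C_mul, if_true]
    ring
  · rw [MvPolynomial.pderiv_X_of_ne (Ne.symm h)]
    simp only [smul_eq_mul, MvPolynomial.smul_eq_C_mul, if_neg h, map_zero]
    ring

theorem pderiv_comm {n : ℕ} (j k : Fin n) (p : Poly n) :
    MvPolynomial.pderiv j (MvPolynomial.pderiv k p) =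
      MvPolynomial.pderiv k (MvPolynomial.pderiv j p) := by
  have : ⁅MvPolynomial.pderiv (R := ℂ[T;T⁻¹]) j, MvPolynomial.pderiv (R := ℂ[T;T⁻¹]) k⁆ = 0 := by
    refine MvPolynomial.derivation_ext fun i => ?_
    rw [Derivation.commutator_apply]
    simp [MvPolynomial.pderiv_X, Pi.single_apply, apply_ite]
  have h := congrArg (fun D : Derivation ℂ[T;T⁻¹] (Poly n) (Poly n) => D p) this
  simpa [Derivation.commutator_apply, sub_eq_zero] using h

/-- The cross terms of the two orders are iħ a_kj and iħ a_jk, equal because a is symmetric. -/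
theorem momOp_comm {n : ℕ} (a : SymMat n) (j k : Fin n) (p : Poly n) :
    momOp a j (momOp a k p) = momOp a k (momOp a j p) := by
  simp only [momOp_apply, map_add, Derivation.map_smul, Derivation.leibniz, pderiv_linForm,
    pderiv_comm j k p, a.2.apply k j]
  simp only [smul_eq_mul, MvPolynomial.smul_eq_C_mul]
  ring

/-- The operator `x̂_j` on `exp(aŷ_{I,J}²/2iħ) · Poly n`. -/
def xOp {n : ℕ} (I : Finset (Fin n)) (a : SymMat n) (j : Fin n) : Module.End ℂ[T;T⁻¹] (Poly n) :=
  if j ∈ I then LinearMap.mulLeft ℂ[T;T⁻¹] (MvPolynomial.X j) else -momOp a j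

/-- The operator `ξ̂_j` on `exp(aŷ_{I,J}²/2iħ) · Poly n`. -/
def xiOp {n : ℕ} (I : Finset (Fin n)) (a : SymMat n) (j : Fin n) : Module.End ℂ[T;T⁻¹] (Poly n) :=
  if j ∈ I then momOp a j else LinearMap.mulLeft ℂ[T;T⁻¹] (MvPolynomial.X j)

theorem xOp_comm {n : ℕ} (I : Finset (Fin n)) (a : SymMat n) (j k : Fin n) (p : Poly n) :
    xOp I a j (xOp I a k p) = xOp I a k (xOp I a j p) := by
  by_cases hj : j ∈ I <;> by_cases hk : k ∈ I
  · simp only [xOp, hj, hk, if_true, LinearMap.mulLeft_apply]; ring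
  · have : k ≠ j := fun h => hk (h ▸ hj)
    simp [xOp, hj, hk, momOp_X_mul, this]
    ring
  · have : j ≠ k := fun h => hj (h ▸ hk)
    simp [xOp, hj, hk, momOp_X_mul, this]
    ring
  · simp [xOp, hj, hk, momOp_comm a j k]

theorem xiOp_comm {n : ℕ} (I : Finset (Fin n)) (a : SymMat n) (j k : Fin n) (p : Poly n) :
    xiOp I a j (xiOp I a k p) = xiOp I a k (xiOp I a j p) := by
  by_cases hj : j ∈ I <;> by_cases hk : k ∈ I
  · simp [xiOp, hj, hk, momOp_comm a j k]
  · have : j ≠ k := fun h => hk (h ▸ hj)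
    simp [xiOp, hj, hk, momOp_X_mul, this]
  · have : k ≠ j := fun h => hj (h ▸ hk)
    simp [xiOp, hj, hk, momOp_X_mul, this]
  · simp only [xiOp, hj, hk, if_false, LinearMap.mulLeft_apply]; ring

/-- The relations have the same form for every I because the exchange (x, ξ) ↦ (ξ, -x) is
symplectic; this is the reason for the sign in `xOp`. -/
theorem xiOp_xOp {n : ℕ} (I : Finset (Fin n)) (a : SymMat n) (j k : Fin n) (p : Poly n) :
    xiOp I a j (xOp I a k p) = xOp I a k (xiOp I a j p) + (if j = k then iħ else 0) • p := by
  by_cases hj : j ∈ I <;> by_cases hk : k ∈ I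
  · simp [xOp, xiOp, hj, hk, momOp_X_mul]
  · have : j ≠ k := fun h => hk (h ▸ hj)
    simp [xOp, xiOp, hj, hk, momOp_comm a j k, this]
  · have : j ≠ k := fun h => hj (h ▸ hk)
    simp only [xOp, xiOp, hj, hk, if_false, if_true, LinearMap.mulLeft_apply, this, zero_smul]
    ring
  · simp only [xOp, xiOp, hj, hk, if_false, LinearMap.mulLeft_apply, LinearMap.neg_apply,
      momOp_X_mul, eq_comm (a := k)]
    ring

/-! ## Intertwining operators -/

/-- The operators that commute with all `x̂_j` and `ξ̂_j` and preserve the vacuum vector. -/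
structure Intertwines {n : ℕ} (I : Finset (Fin n)) (a : SymMat n) (K : Finset (Fin n))
    (b : SymMat n) (D : Module.End ℂ[T;T⁻¹] (Poly n)) : Prop where
  one : D 1 = 1
  x : ∀ j p, D (xOp I a j p) = xOp K b j (D p)
  xi : ∀ j p, D (xiOp I a j p) = xiOp K b j (D p)

/-- The operator `ŷ_j` of the chart `(I, J)`, in the presentation of the chart `K`. -/
def coordOp {n : ℕ} (I K : Finset (Fin n)) (b : SymMat n) (j : Fin n) :
    Module.End ℂ[T;T⁻¹] (Poly n) := if j ∈ I then xOp K b j else xiOp K b j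

theorem coordOp_self {n : ℕ} (I : Finset (Fin n)) (a : SymMat n) (j : Fin n) :
    coordOp I I a j = LinearMap.mulLeft ℂ[T;T⁻¹] (MvPolynomial.X j) := by
  by_cases h : j ∈ I <;> simp [coordOp, xOp, xiOp, h]

theorem coordOp_comm {n : ℕ} (I K : Finset (Fin n)) (b : SymMat n) (j k : Fin n) (p : Poly n) :
    coordOp I K b j (coordOp I K b k p) = coordOp I K b k (coordOp I K b j p) := by
  by_cases hj : j ∈ I <;> by_cases hk : k ∈ I
  · simp [coordOp, hj, hk, xOp_comm K b j k]
  · have : k ≠ j := fun h => hk (h ▸ hj)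
    simp [coordOp, hj, hk, xiOp_xOp, this]
  · have : j ≠ k := fun h => hj (h ▸ hk)
    simp [coordOp, hj, hk, xiOp_xOp, this]
  · simp [coordOp, hj, hk, xiOp_comm K b j k]

theorem Intertwines.X_mul {n : ℕ} {I K : Finset (Fin n)} {a b : SymMat n}
    {D : Module.End ℂ[T;T⁻¹] (Poly n)} (h : Intertwines I a K b D) (j : Fin n) (p : Poly n) :
    D (MvPolynomial.X j * p) = coordOp I K b j (D p) := by
  have := LinearMap.congr_fun (coordOp_self I a j) p
  rw [LinearMap.mulLeft_apply] at this
  rw [← this]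
  by_cases hj : j ∈ I <;> simp [coordOp, hj, h.x, h.xi]

theorem Intertwines.comp {n : ℕ} {I K N : Finset (Fin n)} {a b c : SymMat n}
    {D E : Module.End ℂ[T;T⁻¹] (Poly n)} (hE : Intertwines K b N c E)
    (hD : Intertwines I a K b D) : Intertwines I a N c (E * D) where
  one := by rw [Module.End.mul_apply, hD.one, hE.one]
  x j p := by rw [Module.End.mul_apply, hD.x, hE.x, Module.End.mul_apply]
  xi j p := by rw [Module.End.mul_apply, hD.xi, hE.xi, Module.End.mul_apply]

theorem intertwines_one {n : ℕ} (I : Finset (Fin n)) (a : SymMat n) :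
    Intertwines I a I a 1 := ⟨rfl, fun _ _ => rfl, fun _ _ => rfl⟩

theorem Poly.linearMap_ext {n : ℕ} {D E : Module.End ℂ[T;T⁻¹] (Poly n)} (h1 : D 1 = E 1)
    (h : ∀ j p, D p = E p → D (MvPolynomial.X j * p) = E (MvPolynomial.X j * p)) : D = E := by
  refine LinearMap.ext fun p => ?_
  induction p using MvPolynomial.induction_on with
  | C r => rw [← mul_one (MvPolynomial.C r), ← MvPolynomial.smul_eq_C_mul, map_smul, map_smul, h1]
  | add p q hp hq => rw [map_add, map_add, hp, hq]
  | mul_X p j hp => rw [mul_comm]; exact h j p hp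

/-- The vacuum 1 is cyclic: multiplications by the X_j produce all polynomials from it, and the
intertwiner is prescribed on 1 and on each such product. This replaces a computation with iterated
Fourier integrals. -/
theorem Intertwines.unique {n : ℕ} {I K : Finset (Fin n)} {a b : SymMat n}
    {D E : Module.End ℂ[T;T⁻¹] (Poly n)} (hD : Intertwines I a K b D)
    (hE : Intertwines I a K b E) : D = E :=
  Poly.linearMap_ext (hD.one.trans hE.one.symm) fun j p h => by rw [hD.X_mul, hE.X_mul, h]

/-- The link between operators and geometry: applied to the vacuum, x̂_j gives the linear form that
represents the function x_j on L in the coordinates of the chart. -/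
theorem exists_xOp_one {n : ℕ} (K : Finset (Fin n)) (b : SymMat n) (j : Fin n) :
    ∃ r, xOp K b j 1 = linForm r ∧ ∀ v ∈ graph K b, r ⬝ᵥ pos K v = v.1 j := by
  by_cases hj : j ∈ K
  · exact ⟨Pi.single j 1, by simp [xOp, hj, linForm_single], fun v _ => by simp [pos, hj]⟩
  · refine ⟨-b.1 j, by simp [xOp, hj, linForm_neg, momOp_apply], fun v hv => ?_⟩
    have : mom K v j = b.1 j ⬝ᵥ pos K v := by rw [mem_graph.1 hv]; rfl
    rw [neg_dotProduct, ← this]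
    simp [mom, hj]

theorem exists_xiOp_one {n : ℕ} (K : Finset (Fin n)) (b : SymMat n) (j : Fin n) :
    ∃ r, xiOp K b j 1 = linForm r ∧ ∀ v ∈ graph K b, r ⬝ᵥ pos K v = v.2 j := by
  by_cases hj : j ∈ K
  · refine ⟨b.1 j, by simp [xiOp, hj, momOp_apply], fun v hv => ?_⟩
    have : mom K v j = b.1 j ⬝ᵥ pos K v := by rw [mem_graph.1 hv]; rfl
    rw [← this]
    simp [mom, hj]
  · exact ⟨Pi.single j 1, by simp [xiOp, hj, linForm_single], fun v _ => by simp [pos, hj]⟩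

/-- The vacuum vector is annihilated by the linear forms that vanish on the Lagrangian subspace. -/
theorem sum_coordOp_one {n : ℕ} {I K : Finset (Fin n)} {a b : SymMat n}
    (h : chart I a = chart K b) (j : Fin n) :
    ∑ k, ofRealPoly n (a.1 j k) * coordOp I K b k 1 =
      if j ∈ I then xiOp K b j 1 else -xOp K b j 1 := by
  have hg : graph I a = graph K b := congrArg Subtype.val h
  have h1 : ∀ k, ∃ r, coordOp I K b k 1 = linForm r ∧
      ∀ v ∈ graph K b, r ⬝ᵥ pos K v = pos I v k := by
    intro k
    by_cases hk : k ∈ I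
    · obtain ⟨r, hr, hr'⟩ := exists_xOp_one K b k
      exact ⟨r, by simp [coordOp, hk, hr], fun v hv => by simp [pos, hk, ← hr' v hv]⟩
    · obtain ⟨r, hr, hr'⟩ := exists_xiOp_one K b k
      exact ⟨r, by simp [coordOp, hk, hr], fun v hv => by simp [pos, hk, ← hr' v hv]⟩
  have h2 : ∃ r, (if j ∈ I then xiOp K b j 1 else -xOp K b j 1) = linForm r ∧
      ∀ v ∈ graph K b, r ⬝ᵥ pos K v = mom I v j := by
    by_cases hj : j ∈ I
    · obtain ⟨r, hr, hr'⟩ := exists_xiOp_one K b j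
      exact ⟨r, by simp [hj, hr], fun v hv => by simp [mom, hj, ← hr' v hv]⟩
    · obtain ⟨r, hr, hr'⟩ := exists_xOp_one K b j
      exact ⟨-r, by simp [hj, hr, linForm_neg], fun v hv => by simp [mom, hj, ← hr' v hv]⟩
  choose r hr hr' using h1
  obtain ⟨s, hs, hs'⟩ := h2
  rw [hs, Finset.sum_congr rfl fun k _ => by rw [hr k], ← linForm_sum]
  congr 1
  -- Linear forms in the coordinates of the chart K are compared on points of L, where the equation
  -- of `graph I a` is available.
  refine dotProduct_eq _ _ fun y => ?_
  obtain ⟨v, hv, rfl⟩ := exists_mem_graph K b y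
  rw [hs' v hv, mem_graph.1 (hg ▸ hv), sum_dotProduct]
  simp only [smul_dotProduct, hr' _ v hv]
  rfl

/-- Compatibility with the ŷ_j forces compatibility with their momenta: the commutation relations
carry it from p to X_k p, and on 1 it says that the vacuum is annihilated by the equations of L,
which is `sum_coordOp_one`. -/
theorem Intertwines.of_X_mul {n : ℕ} {I K : Finset (Fin n)} {a b : SymMat n}
    (h : chart I a = chart K b) {D : Module.End ℂ[T;T⁻¹] (Poly n)} (h1 : D 1 = 1)
    (hX : ∀ j p, D (MvPolynomial.X j * p) = coordOp I K b j (D p)) : Intertwines I a K b D := by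
  have key : ∀ j, D * momOp a j = (if j ∈ I then xiOp K b j else -xOp K b j) * D := by
    intro j
    refine Poly.linearMap_ext ?_ fun k p hp => ?_
    · rw [Module.End.mul_apply, Module.End.mul_apply, h1, momOp_apply, mul_one]
      have := sum_coordOp_one h j
      have hX1 : ∀ k, D (MvPolynomial.X k) = coordOp I K b k 1 := fun k => by
        rw [← h1, ← hX, mul_one]
      simp only [Derivation.map_one_eq_zero, smul_zero, zero_add]
      rw [linForm, map_sum]
      simp only [ofRealPoly_mul, map_smul] at this ⊢
      simp only [hX1, this]
      split_ifs <;> rfl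
    · rw [Module.End.mul_apply, Module.End.mul_apply] at hp ⊢
      rw [momOp_X_mul, map_add, map_smul, hX, hp, hX]
      by_cases hj : j ∈ I <;> by_cases hk : k ∈ I
      · simp [coordOp, hj, hk, xiOp_xOp]
      · have : j ≠ k := fun h => hk (h ▸ hj)
        simp [coordOp, hj, hk, xiOp_comm K b j k, this]
      · have : j ≠ k := fun h => hj (h ▸ hk)
        simp [coordOp, hj, hk, xOp_comm K b j k, this]
      · simp [coordOp, hj, hk, xiOp_xOp, eq_comm (a := k)]
  refine ⟨h1, fun j p => ?_, fun j p => ?_⟩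
  · by_cases hj : j ∈ I
    · rw [xOp, if_pos hj, LinearMap.mulLeft_apply, hX, coordOp, if_pos hj]
    · have := LinearMap.congr_fun (key j) p
      rw [Module.End.mul_apply, Module.End.mul_apply, if_neg hj, LinearMap.neg_apply] at this
      rw [xOp, if_neg hj, LinearMap.neg_apply, map_neg, this, neg_neg]
  · by_cases hj : j ∈ I
    · have := LinearMap.congr_fun (key j) p
      rw [Module.End.mul_apply, Module.End.mul_apply, if_pos hj] at this
      rw [xiOp, if_pos hj, this]
    · rw [xiOp, if_neg hj, LinearMap.mulLeft_apply, hX, coordOp, if_neg hj]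

/-- The operator substituted for `ŷ_j` in the transform is the original coordinate operator, read in
the new chart. The sign `dualSign` accounts for η_j = -ξ_j or η_j = x_j. -/
theorem dualOp_eq {n : ℕ} (I A : Finset (Fin n)) (a : SymMat n) (j : Fin n) :
    dualOp I A a j = coordOp I (symmDiff I A) (fourierForm I A a) j := by
  by_cases hj : j ∈ A
  · have h1 : linForm ((fourierForm I A a).1 j) = MvPolynomial.C (LaurentPolynomial.C
        ((-dualSign I j : ℝ) : ℂ)) * ∑ k, MvPolynomial.C (LaurentPolynomial.C
        (((blockInv A a * shiftMat I A a) j k : ℝ) : ℂ)) * MvPolynomial.X k := by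
      rw [linForm, Finset.mul_sum]
      refine Finset.sum_congr rfl fun k _ => ?_
      rw [fourierForm_row_mem a hj, map_mul, mul_assoc]
      rfl
    refine LinearMap.ext fun p => ?_
    by_cases hI : j ∈ I
    · simp only [dualOp, coordOp, xOp, Finset.mem_symmDiff, hj, hI, momOp, h1, iħ, dualSign,
        if_true]
      simp [MvPolynomial.smul_eq_C_mul]
      ring
    · simp only [dualOp, coordOp, xiOp, Finset.mem_symmDiff, hj, hI, momOp, h1, iħ, dualSign,
        if_true]
      simp [MvPolynomial.smul_eq_C_mul]
      ring
  · by_cases hI : j ∈ I <;> simp [dualOp, coordOp, xOp, xiOp, Finset.mem_symmDiff, hj, hI]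

theorem dualSubst_one {n : ℕ} (I A : Finset (Fin n)) (a : SymMat n) : dualSubst I A a 1 = 1 := by
  have : (1 : Poly n) = MvPolynomial.basisMonomials (Fin n) ℂ[T;T⁻¹] 0 := by
    rw [MvPolynomial.coe_basisMonomials]; rfl
  conv_lhs => rw [this]
  rw [dualSubst, Module.Basis.constr_basis]
  simp

/-- `dualSubst` is defined through ordered products; commutativity lets one more factor move to the
front. -/
theorem List.prod_map_pow_add_single {ι M : Type*} [DecidableEq ι] [Monoid M] {f : ι → M}
    (hf : ∀ i j, Commute (f i) (f j)) (α : ι → ℕ) (j : ι) (l : List ι) (hl : l.Nodup)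
    (hj : j ∈ l) : (l.map fun k => f k ^ (α k + if k = j then 1 else 0)).prod =
      f j * (l.map fun k => f k ^ α k).prod := by
  induction l with
  | nil => simp at hj
  | cons k l ih =>
    rw [List.map_cons, List.map_cons, List.prod_cons, List.prod_cons]
    obtain ⟨hk, hl⟩ := List.nodup_cons.1 hl
    by_cases hkj : k = j
    · subst hkj
      have : (l.map fun i => f i ^ (α i + if i = k then 1 else 0)) = l.map fun i => f i ^ α i :=
        List.map_congr_left fun i hi => by
          rw [if_neg fun h : i = k => hk (h ▸ hi), add_zero]
      rw [this, if_pos rfl, pow_succ', mul_assoc]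
    · rw [ih hl ((List.mem_cons.1 hj).resolve_left (Ne.symm hkj)), if_neg hkj, add_zero,
        ← mul_assoc, ← mul_assoc, ((hf k j).pow_left _).eq]

theorem dualSubst_X_mul {n : ℕ} (I A : Finset (Fin n)) (a : SymMat n) (j : Fin n) (p : Poly n) :
    dualSubst I A a (MvPolynomial.X j * p) = dualOp I A a j (dualSubst I A a p) := by
  have hc : ∀ i k, Commute (dualOp I A a i) (dualOp I A a k) := fun i k => by
    rw [dualOp_eq, dualOp_eq]
    exact LinearMap.ext fun p => coordOp_comm _ _ _ i k p
  have : dualSubst I A a ∘ₗ LinearMap.mulLeft ℂ[T;T⁻¹] (MvPolynomial.X j) =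
      dualOp I A a j ∘ₗ dualSubst I A a := by
    refine (MvPolynomial.basisMonomials (Fin n) ℂ[T;T⁻¹]).ext fun α => ?_
    have hX : MvPolynomial.X j * MvPolynomial.basisMonomials (Fin n) ℂ[T;T⁻¹] α =
        MvPolynomial.basisMonomials (Fin n) ℂ[T;T⁻¹] (α + Finsupp.single j 1) := by
      simp only [MvPolynomial.coe_basisMonomials, MvPolynomial.X, MvPolynomial.monomial_mul,
        one_mul, add_comm]
    rw [LinearMap.comp_apply, LinearMap.comp_apply, LinearMap.mulLeft_apply, hX]
    simp only [dualSubst, Module.Basis.constr_basis]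
    rw [← Module.End.mul_apply, List.ofFn_eq_map, List.ofFn_eq_map,
      ← List.prod_map_pow_add_single hc _ j _ (List.nodup_finRange n) (List.mem_finRange j)]
    congr 3
    ext1 k
    rw [Finsupp.add_apply, Finsupp.single_apply]
    simp only [eq_comm]
  exact LinearMap.congr_fun this p

theorem dualSubst_intertwines {n : ℕ} (I A : Finset (Fin n)) (a : SymMat n)
    (hA : (block A a).det ≠ 0) :
    Intertwines I a (symmDiff I A) (fourierForm I A a) (dualSubst I A a) :=
  .of_X_mul (chart_fourierForm I A a hA).symm (dualSubst_one I A a) fun j p => by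
    rw [dualSubst_X_mul, dualOp_eq]

/-! ## The scalar of the Fourier transform -/

/-- The determinant of `1 + ia`. Up to a power of `i`, it is the determinant of the frame of
`L_{I,J}(a) ⊂ ℂⁿ` given by the coordinates `ŷ_{I,J}`. -/
def maslovDet {n : ℕ} (a : SymMat n) : ℂ :=
  (1 + Complex.I • a.1.map ((↑) : ℝ → ℂ)).det

/-- (1 - ia)(1 + ia) = 1 + a² is positive definite for real symmetric a. -/
theorem maslovDet_ne_zero {n : ℕ} (a : SymMat n) : maslovDet a ≠ 0 := by
  have h : (1 - Complex.I • a.1.map ((↑) : ℝ → ℂ)) * (1 + Complex.I • a.1.map ((↑) : ℝ → ℂ)) =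
      (1 + a.1 * a.1).map Complex.ofRealHom := by
    rw [Matrix.map_add _ (map_add _), Matrix.map_mul, Matrix.map_one _ (map_zero _) (map_one _)]
    rw [sub_mul, mul_add, mul_add, one_mul, mul_one, one_mul, smul_mul_smul_comm, Complex.I_mul_I,
      neg_one_smul]
    change _ = 1 + a.1.map ((↑) : ℝ → ℂ) * a.1.map ((↑) : ℝ → ℂ)
    abel
  have hpos : 0 < (1 + a.1 * a.1).det := by
    refine Matrix.PosDef.det_pos (Matrix.PosDef.one.add_posSemidef ?_)
    have := Matrix.posSemidef_conjTranspose_mul_self a.1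
    rwa [conjTranspose_eq_transpose_of_trivial, a.2.eq] at this
  intro h0
  have hd := congrArg det h
  rw [det_mul, ← maslovDet, h0, mul_zero] at hd
  have := RingHom.map_det Complex.ofRealHom (1 + a.1 * a.1)
  rw [RingHom.mapMatrix_apply, ← hd] at this
  exact hpos.ne' (by simpa using this)

theorem mul_posMat {n : ℕ} {I A : Finset (Fin n)} {a b : SymMat n}
    (h : chart I a = chart (symmDiff I A) b) : b.1 * posMat I A a = momMat I A a := by
  have hg : graph I a = graph (symmDiff I A) b := congrArg Subtype.val h
  refine Matrix.mulVec_injective (funext fun y => ?_)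
  obtain ⟨v, hv, rfl⟩ := exists_mem_graph I a y
  rw [← mulVec_mulVec, ← pos_eq_posMat A hv, ← mom_eq_momMat A hv, mem_graph.1 (hg ▸ hv)]

/-- In each coordinate j ∈ A the new ŷ + i·(momentum) is i·`dualSign` times the old one, and outside
A nothing changes. Restricted to L this is the matrix identity (1 + ib)·`posMat` = diagonal·(1 +
ia), whose determinants are compared. -/
theorem maslovDet_eq {n : ℕ} {I A : Finset (Fin n)} {a b : SymMat n}
    (h : chart I a = chart (symmDiff I A) b) :
    maslovDet a = Complex.I ^ A.card * (block A a).det * maslovDet b := by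
  have hm : (1 + Complex.I • b.1.map ((↑) : ℝ → ℂ)) * (posMat I A a).map Complex.ofRealHom =
      diagonal (fun i => if i ∈ A then Complex.I * (dualSign I i : ℂ) else 1) *
        (1 + Complex.I • a.1.map ((↑) : ℝ → ℂ)) := by
    have h1 : b.1.map ((↑) : ℝ → ℂ) * (posMat I A a).map Complex.ofRealHom =
        (momMat I A a).map Complex.ofRealHom := by
      rw [← mul_posMat h, Matrix.map_mul]; rfl
    rw [add_mul, smul_mul_assoc, h1, one_mul]
    ext i j
    rw [diagonal_mul]
    by_cases hi : i ∈ A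
    · by_cases hij : i = j
      · subst hij
        simp [posMat, momMat, hi]
        linear_combination (-(dualSign I i : ℂ) * a.1 i i) * Complex.I_mul_I
      · simp [posMat, momMat, hi, hij]
        linear_combination (-(dualSign I i : ℂ) * a.1 i j) * Complex.I_mul_I
    · by_cases hij : i = j
      · subst hij; simp [posMat, momMat, hi]
      · simp [posMat, momMat, hi, hij]
  have hd := congrArg det hm
  rw [det_mul, det_mul, det_diagonal, ← maslovDet, ← maslovDet, Finset.prod_ite_mem,
    Finset.univ_inter, ← RingHom.mapMatrix_apply, ← RingHom.map_det, det_posMat] at hd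
  have hs : (∏ i ∈ A, (dualSign I i : ℂ)) * ∏ i ∈ A, (dualSign I i : ℂ) = 1 := by
    rw [← Finset.prod_mul_distrib]
    refine Finset.prod_eq_one fun i _ => ?_
    exact_mod_cast dualSign_mul_self I i
  simp only [Finset.prod_neg, Finset.prod_mul_distrib, Finset.prod_const, map_mul, map_pow,
    map_neg, map_one, map_prod, Complex.ofRealHom_eq_coe] at hd
  have hI : Complex.I ^ A.card * Complex.I ^ A.card = (-1) ^ A.card := by
    rw [← mul_pow, Complex.I_mul_I]
  have h1 : ((-1 : ℂ) ^ A.card) * (-1) ^ A.card = 1 := by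
    rw [← mul_pow]; simp
  set P := ∏ i ∈ A, (dualSign I i : ℂ)
  -- The signs in `det_posMat` and in the diagonal cancel because each squares to 1; what remains
  -- uses i^|A| · i^|A| = (-1)^|A|.
  linear_combination (-((-1) ^ A.card * Complex.I ^ A.card * P)) * hd +
    (Complex.I ^ A.card * P ^ 2 * maslovDet b * (block A a).det - P ^ 2 * maslovDet a) * h1 -
    (-1) ^ A.card * P ^ 2 * maslovDet a * hI +
    (Complex.I ^ A.card * (block A a).det * maslovDet b - maslovDet a) * hs

/-- The coordinate of the section `1_{I,J}` in a global frame of the bundle of lines. -/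
def weight {n : ℕ} (a : SymMat n) : ℂ :=
  maslovDet a / (‖maslovDet a‖ * Real.sqrt ‖maslovDet a‖ : ℝ)

theorem weight_ne_zero {n : ℕ} (a : SymMat n) : weight a ≠ 0 := by
  have h := norm_pos_iff.2 (maslovDet_ne_zero a)
  refine div_ne_zero (maslovDet_ne_zero a) ?_
  have : 0 < ‖maslovDet a‖ * Real.sqrt ‖maslovDet a‖ := by positivity
  exact_mod_cast this.ne'

/-- Each nonpositive eigenvalue contributes -1 and there are |A| - p of them. A zero eigenvalue does
no harm, since both sides then vanish. -/
theorem abs_block_det {n : ℕ} (A : Finset (Fin n)) (a : SymMat n) :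
    ((block A a).det : ℂ) = (-1) ^ A.card * (-1) ^ numPos A a * (|(block A a).det| : ℝ) := by
  have h1 : (block A a).det = ∏ i, (block_herm A a).eigenvalues i := by
    simpa using (block_herm A a).det_eq_prod_eigenvalues
  have h2 : ∀ x : ℝ, x = (-1) * (if 0 < x then -1 else 1) * |x| := by
    intro x
    split_ifs with hx
    · rw [abs_of_pos hx]; ring
    · rw [abs_of_nonpos (not_lt.1 hx)]; ring
  have h3 : (block A a).det = (-1) ^ A.card * (-1) ^ numPos A a * |(block A a).det| := by
    rw [h1, Finset.abs_prod]
    conv_lhs => rw [Finset.prod_congr rfl fun i _ => h2 _]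
    rw [Finset.prod_mul_distrib, Finset.prod_mul_distrib, Finset.prod_const, ← Finset.prod_filter,
      Finset.prod_const, numPos]
    simp
  exact_mod_cast h3

/-- By `maslovDet_eq` the quotient of the weights is i^|A| det/|det|^{3/2}, and the sign of the
determinant turns this into (-i)^|A| (-1)^p/√|det|. The Fourier scalars are thus a coboundary on the
charts. -/
theorem fourierConst_mul_weight {n : ℕ} {I A : Finset (Fin n)} {a b : SymMat n}
    (h : chart I a = chart (symmDiff I A) b) : fourierConst A a * weight b = weight a := by
  have hd := block_det_ne_zero h
  have hexp : Complex.exp (-(Real.pi * Complex.I * A.card / 2)) = (-Complex.I) ^ A.card := by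
    rw [← Complex.exp_neg_pi_div_two_mul_I, ← Complex.exp_nat_mul]
    congr 1; ring
  have hn : ‖maslovDet a‖ = |(block A a).det| * ‖maslovDet b‖ := by
    rw [maslovDet_eq h, norm_mul, norm_mul, norm_pow, Complex.norm_I, one_pow, one_mul,
      Complex.norm_real, Real.norm_eq_abs]
  have hb := norm_pos_iff.2 (maslovDet_ne_zero b)
  have hA : 0 < |(block A a).det| := abs_pos.2 hd
  rw [weight, weight, hn, Real.sqrt_mul hA.le, maslovDet_eq h, abs_block_det, fourierConst, hexp]
  have e1 : ((|(block A a).det| : ℝ) : ℂ) ≠ 0 := by exact_mod_cast hA.ne'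
  have e2 : (‖maslovDet b‖ : ℂ) ≠ 0 := by exact_mod_cast hb.ne'
  have e3 : (Real.sqrt |(block A a).det| : ℂ) ≠ 0 := by exact_mod_cast (Real.sqrt_pos.2 hA).ne'
  have e4 : (Real.sqrt ‖maslovDet b‖ : ℂ) ≠ 0 := by exact_mod_cast (Real.sqrt_pos.2 hb).ne'
  have e5 : Complex.I ^ A.card * (-1) ^ A.card = (-Complex.I) ^ A.card := by
    rw [← mul_pow]; simp
  rw [← e5]
  push_cast
  field_simp

/-! ## The fibers of `ℋ` -/

theorem fourier_apply {n : ℕ} (I A : Finset (Fin n)) (a : SymMat n) (f : Coef n) (c : ℂ) (k : ℤ) :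
    (fourier I A a f).1 c k = fourierConst A a • dualSubst I A a (f.1 c k) := rfl

/-- Both sides intertwine the same operators, so the polynomial parts agree by uniqueness; the
scalars agree because each is a quotient of weights. -/
theorem fourier_fourier {n : ℕ} {I A B : Finset (Fin n)} {a : SymMat n}
    (hA : (block A a).det ≠ 0) (hB : (block B (fourierForm I A a)).det ≠ 0) (f : Coef n) :
    fourier (symmDiff I A) B (fourierForm I A a) (fourier I A a f) =
      fourier I (symmDiff A B) a f := by
  have h1 := chart_fourierForm I A a hA
  have h2 := chart_fourierForm (symmDiff I A) B _ hB
  rw [symmDiff_assoc] at h2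
  obtain ⟨h3, h4⟩ := chart_eq_iff.1 (h2.trans h1)
  have hi := (dualSubst_intertwines _ B _ hB).comp (dualSubst_intertwines I A a hA)
  rw [symmDiff_assoc, h4] at hi
  have hD := hi.unique (dualSubst_intertwines I (symmDiff A B) a h3)
  have hc : fourierConst B (fourierForm I A a) * fourierConst A a =
      fourierConst (symmDiff A B) a := by
    have k1 := fourierConst_mul_weight h1.symm
    have k2 := fourierConst_mul_weight (I := symmDiff I A) (A := B) (a := fourierForm I A a)
      (b := fourierForm I (symmDiff A B) a) (by rw [symmDiff_assoc, ← h4]; exact h2.symm)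
    have k3 := fourierConst_mul_weight (chart_fourierForm I _ a h3).symm
    refine mul_right_cancel₀ (weight_ne_zero (fourierForm I (symmDiff A B) a)) ?_
    rw [k3, ← k1, ← k2]
    ring
  refine Subtype.ext (funext fun c => funext fun k => ?_)
  rw [fourier_apply, fourier_apply, fourier_apply, ← hD, ← hc, ← C_smul (fourierConst A a),
    map_smul, C_smul, smul_smul, Module.End.mul_apply]

theorem fourier_empty {n : ℕ} (I : Finset (Fin n)) (a : SymMat n) (f : Coef n) :
    fourier I ∅ a f = f := by
  have hd : (block ∅ a).det ≠ 0 := by rw [det_isEmpty]; exact one_ne_zero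
  have hs : symmDiff I ∅ = I := symmDiff_bot I
  have ha : fourierForm I ∅ a = a := by
    have := chart_fourierForm I ∅ a hd
    rw [hs] at this
    exact chart_injective _ this
  have hi := dualSubst_intertwines I ∅ a hd
  rw [hs, ha] at hi
  have hD := hi.unique (intertwines_one I a)
  have hc : fourierConst ∅ a = 1 := by
    refine mul_right_cancel₀ (weight_ne_zero a) ?_
    rw [fourierConst_mul_weight (I := I) (by rw [hs]), one_mul]
  refine Subtype.ext (funext fun c => funext fun k => ?_)
  rw [fourier_apply, hD, hc, one_smul, Module.End.one_apply]

theorem fourier_one {n : ℕ} (I A : Finset (Fin n)) (a : SymMat n) :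
    fourier I A a (Coef.one n) = fourierConst A a • Coef.one n := by
  refine Subtype.ext (funext fun c => funext fun k => ?_)
  rw [fourier_apply]
  change _ = fourierConst A a • (Coef.one n).1 c k
  congr 1
  by_cases hc : c = 0
  · subst hc
    by_cases hk : k = 0
    · subst hk; simp [Coef.one, dualSubst_one]
    · simp [Coef.one, hk]
  · simp [Coef.one, hc]

open Classical in
/-- The map that expresses all vectors of the fiber at `L_{I,J}(a)` in the chart `(I, J)`, and
discards the vectors of the other fibers. -/
def toChart {n : ℕ} (I : Finset (Fin n)) (a : SymMat n) : PreWeil n →ₗ[ℂ] Coef n :=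
  Finsupp.lsum ℂ fun p => if chart p.1 p.2 = chart I a then fourier p.1 (symmDiff p.1 I) p.2 else 0

theorem toChart_single {n : ℕ} {I K : Finset (Fin n)} {a b : SymMat n}
    (h : chart K b = chart I a) (f : Coef n) :
    toChart I a (Finsupp.single (K, b) f) = fourier K (symmDiff K I) b f := by
  simp [toChart, h]

theorem toChart_single_of_ne {n : ℕ} {I K : Finset (Fin n)} {a b : SymMat n}
    (h : chart K b ≠ chart I a) (f : Coef n) :
    toChart I a (Finsupp.single (K, b) f) = 0 := by
  simp [toChart, h]

/-- The two terms of a relation lie over the same L, and transforming either of them to the chart I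
gives the same result by `fourier_fourier`. -/
theorem weilRel_le_ker_toChart {n : ℕ} (I : Finset (Fin n)) (a : SymMat n) :
    weilRel n ≤ LinearMap.ker (toChart I a) := by
  refine Submodule.span_le.2 ?_
  rintro _ ⟨K, A, b, f, hA, rfl⟩
  have hb := chart_fourierForm K A b hA
  rw [SetLike.mem_coe, LinearMap.mem_ker, map_sub, sub_eq_zero]
  by_cases h : chart K b = chart I a
  · rw [toChart_single h, toChart_single (hb.trans h), fourier_fourier hA]
    · rw [symmDiff_assoc, symmDiff_left_comm, symmDiff_symmDiff_cancel_left]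
    · refine block_det_ne_zero (I := symmDiff K A) (b := a) ?_
      rw [hb, h, symmDiff_symmDiff_cancel_left]
  · rw [toChart_single_of_ne h, toChart_single_of_ne (by rwa [hb])]

/-- `toChart` descends to the quotient and is a left inverse, so the relations impose nothing inside
a single chart. -/
theorem incl_injective {n : ℕ} (I : Finset (Fin n)) (a : SymMat n) :
    Function.Injective (incl I a) := by
  have : Function.LeftInverse ((weilRel n).liftQ _ (weilRel_le_ker_toChart I a)) (incl I a) := by
    intro f
    change toChart I a (Finsupp.single (I, a) f) = f
    rw [toChart_single rfl, symmDiff_self]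
    exact fourier_empty I a f
  exact this.injective

theorem incl_eq {n : ℕ} {I K : Finset (Fin n)} {a b : SymMat n} (h : chart I a = chart K b)
    (f : Coef n) : incl I a f = incl K b (fourier I (symmDiff I K) a f) := by
  obtain ⟨A, rfl⟩ : ∃ A, K = symmDiff I A := ⟨symmDiff I K, (symmDiff_symmDiff_cancel_left I K).symm⟩
  obtain ⟨hA, rfl⟩ := chart_eq_iff.1 h.symm
  rw [symmDiff_symmDiff_cancel_left]
  refine (Submodule.Quotient.eq _).2 (Submodule.subset_span ⟨I, A, a, f, hA, rfl⟩)

theorem unitVec_eq {n : ℕ} {I K : Finset (Fin n)} {a b : SymMat n} (h : chart I a = chart K b) :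
    unitVec I a = (weight a / weight b) • unitVec K b := by
  obtain ⟨A, rfl⟩ : ∃ A, K = symmDiff I A := ⟨symmDiff I K, (symmDiff_symmDiff_cancel_left I K).symm⟩
  rw [unitVec, incl_eq h, symmDiff_symmDiff_cancel_left, fourier_one, map_smul,
    ← fourierConst_mul_weight h, mul_div_cancel_right₀ _ (weight_ne_zero b), unitVec]

theorem range_incl {n : ℕ} (I : Finset (Fin n)) (a : SymMat n) :
    LinearMap.range (incl I a) = fiber (chart I a) := by
  refine le_antisymm ?_ (Submodule.span_le.2 ?_)
  · rintro _ ⟨f, rfl⟩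
    exact Submodule.subset_span ⟨I, a, f, rfl, rfl⟩
  · rintro _ ⟨K, b, f, h, rfl⟩
    exact ⟨_, (incl_eq h f).symm⟩

theorem lineAt_chart {n : ℕ} (I : Finset (Fin n)) (a : SymMat n) :
    lineAt (chart I a) = ℂ ∙ unitVec I a := by
  refine le_antisymm (Submodule.span_le.2 ?_) (Submodule.span_le.2 ?_)
  · rintro _ ⟨K, b, h, rfl⟩
    rw [unitVec_eq h]
    exact Submodule.smul_mem _ _ (Submodule.mem_span_singleton_self _)
  · rintro _ rfl
    exact unitVec_mem I a

theorem unitVec_ne_zero {n : ℕ} (I : Finset (Fin n)) (a : SymMat n) : unitVec I a ≠ 0 := by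
  intro h
  have h1 : Coef.one n = 0 := incl_injective I a (h.trans (map_zero _).symm)
  have h2 : (Coef.one n).1 0 0 = 0 := by rw [h1]; rfl
  simp [Coef.one] at h2

/-! ## The topology of `Λ(n)` -/

theorem continuous_block {n : ℕ} (A : Finset (Fin n)) :
    Continuous fun a : SymMat n => block A a :=
  Continuous.matrix_submatrix continuous_subtype_val _ _

theorem continuousOn_fourierForm {n : ℕ} (I A : Finset (Fin n)) :
    ContinuousOn (fourierForm I A) {a | (block A a).det ≠ 0} := by
  have hinv : ContinuousOn (fun a : SymMat n => (block A a)⁻¹) {a | (block A a).det ≠ 0} := by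
    simp only [Matrix.inv_def, Ring.inverse_eq_inv']
    exact ContinuousOn.smul ((continuous_block A).matrix_det.continuousOn.inv₀ fun _ h => h)
      (continuous_block A).matrix_adjugate.continuousOn
  have hblock : ContinuousOn (blockInv A) {a : SymMat n | (block A a).det ≠ 0} := by
    refine continuousOn_pi.2 fun i => continuousOn_pi.2 fun j => ?_
    by_cases h : i ∈ A ∧ j ∈ A
    · simp only [blockInv, h, and_self, dite_true]
      exact continuousOn_pi.1 (continuousOn_pi.1 hinv ⟨i, h.1⟩) ⟨j, h.2⟩
    · simp only [blockInv, h, dite_false]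
      exact continuousOn_const
  have hentry : ∀ i j, Continuous fun a : SymMat n => a.1 i j := fun i j =>
    Continuous.matrix_elem continuous_subtype_val i j
  have hshift : Continuous (shiftMat I A) := by
    refine continuous_matrix fun i j => ?_
    simp only [shiftMat]
    split_ifs
    exacts [continuous_const, continuous_const, hentry i j, continuous_const]
  have hrest : Continuous (restBlock (n := n) A) := by
    refine continuous_matrix fun i j => ?_
    simp only [restBlock]
    split_ifs
    exacts [continuous_const, hentry i j]
  refine Topology.IsInducing.subtypeVal.continuousOn_iff.2 ?_
  exact hrest.continuousOn.sub
    ((hshift.matrix_transpose.continuousOn.mul hblock).mul hshift.continuousOn)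

theorem Lag.isOpen_iff {n : ℕ} {U : Set (Lag n)} :
    IsOpen U ↔ ∀ I, IsOpen (chart I ⁻¹' U) := by
  simp only [isOpen_iSup_iff, isOpen_coinduced]

theorem isOpenEmbedding_chart {n : ℕ} (I : Finset (Fin n)) :
    Topology.IsOpenEmbedding (chart I) := by
  refine .of_continuous_injective_isOpenMap
    (continuous_def.2 fun U hU => Lag.isOpen_iff.1 hU I) (chart_injective I)
    fun O hO => Lag.isOpen_iff.2 fun K => ?_
  -- The transition map between charts is `fourierForm`, defined and continuous on the open set
  -- where the block determinant is nonzero.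
  have : chart K ⁻¹' (chart I '' O) = {b | (block (symmDiff K I) b).det ≠ 0} ∩
      fourierForm K (symmDiff K I) ⁻¹' O := by
    ext b
    constructor
    · rintro ⟨a, ha, h⟩
      rw [← symmDiff_symmDiff_cancel_left K I] at h
      obtain ⟨h1, rfl⟩ := chart_eq_iff.1 h
      exact ⟨h1, ha⟩
    · rintro ⟨h1, h2⟩
      refine ⟨_, h2, ?_⟩
      have := chart_fourierForm K _ b h1
      rwa [symmDiff_symmDiff_cancel_left] at this
  rw [this]
  exact (continuousOn_fourierForm K _).isOpen_inter_preimage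
    (isOpen_ne_fun (continuous_block _).matrix_det continuous_const) hO

instance (n : ℕ) : Nonempty (SymMat n) := ⟨⟨0, isSymm_zero⟩⟩

/-- The inverse of the chart. -/
def chartInv {n : ℕ} (I : Finset (Fin n)) : Lag n → SymMat n := Function.invFun (chart I)

theorem chartInv_chart {n : ℕ} (I : Finset (Fin n)) (a : SymMat n) : chartInv I (chart I a) = a :=
  Function.leftInverse_invFun (chart_injective I) a

theorem continuousOn_chartInv {n : ℕ} (I : Finset (Fin n)) :
    ContinuousOn (chartInv (n := n) I) (Set.range (chart I)) := by
  rintro _ ⟨a, rfl⟩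
  refine ContinuousAt.continuousWithinAt ?_
  rw [(isOpenEmbedding_chart I).continuousAt_iff.symm]
  exact continuousAt_id.congr (.of_forall fun b => (chartInv_chart I b).symm)

theorem continuous_maslovDet {n : ℕ} : Continuous (maslovDet (n := n)) := by
  have h : Continuous fun a : SymMat n => a.1.map ((↑) : ℝ → ℂ) :=
    Continuous.matrix_map continuous_subtype_val Complex.continuous_ofReal
  exact (continuous_const.add (h.const_smul Complex.I)).matrix_det

theorem continuous_weight {n : ℕ} : Continuous (weight (n := n)) := by
  have h := continuous_maslovDet (n := n)
  refine h.div (Complex.continuous_ofReal.comp (h.norm.mul h.norm.sqrt)) fun a => ?_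
  have := norm_pos_iff.2 (maslovDet_ne_zero a)
  have : 0 < ‖maslovDet a‖ * Real.sqrt ‖maslovDet a‖ := by positivity
  exact_mod_cast this.ne'

/-! ## The bundle of lines -/

/-- A nowhere vanishing section of the bundle of lines. -/
def globalVec {n : ℕ} (L : Lag n) : Weil n :=
  (weight (exists_chart L).choose_spec.choose)⁻¹ •
    unitVec (exists_chart L).choose (exists_chart L).choose_spec.choose

/-- Dividing 1_{I,J} by its weight cancels the factor in `unitVec_eq`, so the chosen chart does not
matter. -/
theorem globalVec_chart {n : ℕ} (I : Finset (Fin n)) (a : SymMat n) :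
    globalVec (chart I a) = (weight a)⁻¹ • unitVec I a := by
  have h := (exists_chart (chart I a)).choose_spec.choose_spec
  rw [globalVec, unitVec_eq h, smul_smul]
  congr 1
  have := weight_ne_zero a
  have := weight_ne_zero (exists_chart (chart I a)).choose_spec.choose
  field_simp

theorem globalVec_ne_zero {n : ℕ} (L : Lag n) : globalVec L ≠ 0 :=
  smul_ne_zero (inv_ne_zero (weight_ne_zero _)) (unitVec_ne_zero _ _)

theorem lineAt_eq_span {n : ℕ} (L : Lag n) : lineAt L = ℂ ∙ globalVec L := by
  obtain ⟨I, a, rfl⟩ := exists_chart L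
  rw [lineAt_chart, globalVec_chart,
    Submodule.span_singleton_smul_eq (inv_ne_zero (weight_ne_zero a)).isUnit]

/-- The coordinate on the lines given by the global frame. -/
def lineCoord {n : ℕ} (L : Lag n) : Line n L ≃ₗ[ℂ] ℂ :=
  (LinearEquiv.ofEq _ _ (lineAt_eq_span L)).trans
    (LinearEquiv.toSpanNonzeroSingleton ℂ _ _ (globalVec_ne_zero L)).symm

theorem lineCoord_frame {n : ℕ} (I : Finset (Fin n)) (a : SymMat n) :
    lineCoord (chart I a) (frame I a) = weight a := by
  refine (LinearEquiv.eq_symm_apply _).1 ?_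
  refine Subtype.ext ?_
  change unitVec I a = weight a • globalVec (chart I a)
  rw [globalVec_chart, smul_smul, mul_inv_cancel₀ (weight_ne_zero a), one_smul]

/-- The bijection of the total space with `Λ(n) × ℂ`. -/
def totalEquiv (n : ℕ) : TotalSpace ℂ (Line n) ≃ Lag n × ℂ where
  toFun p := (p.1, lineCoord p.1 p.2)
  invFun q := ⟨q.1, (lineCoord q.1).symm q.2⟩
  left_inv p := by simp
  right_inv q := by simp

theorem totalEquiv_framePar {n : ℕ} (I : Finset (Fin n)) (p : SymMat n × ℂ) :
    totalEquiv n (framePar I p) = (chart I p.1, p.2 * weight p.1) := by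
  change (chart I p.1, lineCoord (chart I p.1) (p.2 • frame I p.1)) = _
  rw [map_smul, lineCoord_frame, smul_eq_mul]

/-- Multiplication by the weight is a fiberwise linear homeomorphism of the chart times ℂ, so the
topology glued from the frames is the product topology. -/
theorem isOpenEmbedding_totalEquiv_framePar {n : ℕ} (I : Finset (Fin n)) :
    Topology.IsOpenEmbedding (totalEquiv n ∘ framePar I) := by
  let s : SymMat n × ℂ ≃ₜ SymMat n × ℂ :=
    { toFun := fun p => (p.1, p.2 * weight p.1)
      invFun := fun p => (p.1, p.2 / weight p.1)
      left_inv := fun p => by simp [weight_ne_zero]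
      right_inv := fun p => by simp [weight_ne_zero]
      continuous_toFun := continuous_fst.prodMk
        (continuous_snd.mul (continuous_weight.comp continuous_fst))
      continuous_invFun := continuous_fst.prodMk
        (continuous_snd.div (continuous_weight.comp continuous_fst) fun p => weight_ne_zero p.1) }
  have : totalEquiv n ∘ framePar I = Prod.map (chart I) id ∘ s :=
    funext fun p => totalEquiv_framePar I p
  rw [this]
  exact ((isOpenEmbedding_chart I).prodMap .id).comp s.isOpenEmbedding

theorem isOpen_total_iff {n : ℕ} {U : Set (TotalSpace ℂ (Line n))} :
    IsOpen U ↔ ∀ I, IsOpen (framePar I ⁻¹' U) := by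
  simp only [isOpen_iSup_iff, isOpen_coinduced]

theorem framePar_surjective {n : ℕ} (v : TotalSpace ℂ (Line n)) : ∃ I p, framePar I p = v := by
  obtain ⟨I, a, h⟩ := exists_chart v.1
  refine ⟨I, (a, (totalEquiv n v).2 / weight a), (totalEquiv n).injective ?_⟩
  rw [totalEquiv_framePar, div_mul_cancel₀ _ (weight_ne_zero a), h]
  rfl

/-- The total space of the bundle of lines is homeomorphic to `Λ(n) × ℂ`. -/
def totalHomeomorph (n : ℕ) : TotalSpace ℂ (Line n) ≃ₜ Lag n × ℂ :=
  (totalEquiv n).toHomeomorphOfContinuousOpen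
    (continuous_def.2 fun U hU => isOpen_total_iff.2 fun I =>
      hU.preimage (isOpenEmbedding_totalEquiv_framePar I).continuous)
    (fun O hO => by
      have : totalEquiv n '' O = ⋃ I, (totalEquiv n ∘ framePar I) '' (framePar I ⁻¹' O) := by
        ext q
        simp only [Set.mem_iUnion]
        constructor
        · rintro ⟨v, hv, rfl⟩
          obtain ⟨I, p, rfl⟩ := framePar_surjective v
          exact ⟨I, p, hv, rfl⟩
        · rintro ⟨I, p, hp, rfl⟩
          exact ⟨_, hp, rfl⟩
      rw [this]
      exact isOpen_iUnion fun I => (isOpenEmbedding_totalEquiv_framePar I).isOpenMap _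
        (isOpen_total_iff.1 hO I))

theorem totalHomeomorph_apply {n : ℕ} (v : TotalSpace ℂ (Line n)) :
    totalHomeomorph n v = (v.1, lineCoord v.1 v.2) := rfl

theorem totalHomeomorph_symm_apply {n : ℕ} (q : Lag n × ℂ) :
    (totalHomeomorph n).symm q = ⟨q.1, (lineCoord q.1).symm q.2⟩ := rfl

theorem continuousOn_weight_chartInv {n : ℕ} (I : Finset (Fin n)) :
    ContinuousOn (fun L => weight (chartInv I L)) (Set.range (chart I)) :=
  continuous_weight.comp_continuousOn (continuousOn_chartInv I)

/-- The local trivialization in which `1_{I,J}` is constant. -/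
def lineTriv {n : ℕ} (I : Finset (Fin n)) : Trivialization ℂ (π ℂ (Line n)) where
  toFun v := (v.1, lineCoord v.1 v.2 / weight (chartInv I v.1))
  invFun q := ⟨q.1, (lineCoord q.1).symm (q.2 * weight (chartInv I q.1))⟩
  source := π ℂ (Line n) ⁻¹' Set.range (chart I)
  target := Set.range (chart I) ×ˢ Set.univ
  map_source' v hv := ⟨hv, trivial⟩
  map_target' q hq := hq.1
  left_inv' v _ := by simp [weight_ne_zero]
  right_inv' q _ := by simp [weight_ne_zero]
  open_source := (isOpenEmbedding_chart I).isOpen_range.preimage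
    (continuous_fst.comp (totalHomeomorph n).continuous)
  open_target := (isOpenEmbedding_chart I).isOpen_range.prod isOpen_univ
  continuousOn_toFun := by
    have h1 : Continuous fun v : TotalSpace ℂ (Line n) => v.1 :=
      continuous_fst.comp (totalHomeomorph n).continuous
    have h2 : Continuous fun v : TotalSpace ℂ (Line n) => lineCoord v.1 v.2 :=
      continuous_snd.comp (totalHomeomorph n).continuous
    exact h1.continuousOn.prodMk (h2.continuousOn.div
      ((continuousOn_weight_chartInv I).comp h1.continuousOn fun v hv => hv)
      fun v _ => weight_ne_zero _)
  continuousOn_invFun := by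
    refine (totalHomeomorph n).symm.continuous.comp_continuousOn
      (f := fun q : Lag n × ℂ => (q.1, q.2 * weight (chartInv I q.1))) ?_
    exact continuous_fst.continuousOn.prodMk (continuous_snd.continuousOn.mul
      ((continuousOn_weight_chartInv I).comp continuous_fst.continuousOn fun q hq => hq.1))
  baseSet := Set.range (chart I)
  open_baseSet := (isOpenEmbedding_chart I).isOpen_range
  source_eq := rfl
  target_eq := rfl
  proj_toFun _ _ := rfl

theorem lineTriv_apply {n : ℕ} (I : Finset (Fin n)) (v : TotalSpace ℂ (Line n)) :
    lineTriv I v = (v.1, lineCoord v.1 v.2 / weight (chartInv I v.1)) := rfl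

/-- The fiber bundle structure on the lines. -/
@[reducible]
def lineFiberBundle (n : ℕ) : FiberBundle ℂ (Line n) where
  totalSpaceMk_isInducing' _ := ⟨rfl⟩
  trivializationAtlas' := Set.range lineTriv
  trivializationAt' L := lineTriv (exists_chart L).choose
  mem_baseSet_trivializationAt' L := (exists_chart L).choose_spec
  trivialization_mem_atlas' _ := ⟨_, rfl⟩

theorem lineTriv_isLinear {n : ℕ} (I : Finset (Fin n)) : (lineTriv I).IsLinear ℂ where
  linear L _ :=
    { map_add := fun v w => by simp [lineTriv_apply, add_div]
      map_smul := fun r v => by simp [lineTriv_apply, mul_div_assoc] }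

theorem lineVectorBundle (n : ℕ) :
    @VectorBundle ℂ (Lag n) ℂ (Line n) _ _ _ _ _ _ _ _ (lineFiberBundle n) := by
  let := lineFiberBundle n
  refine ⟨?_, ?_⟩
  · rintro _ ⟨I, rfl⟩
    exact lineTriv_isLinear I
  · rintro _ _ ⟨I, rfl⟩ ⟨K, rfl⟩
    have := lineTriv_isLinear I
    have := lineTriv_isLinear K
    -- The transition functions of ℓ are the quotients of the weights.
    have : ContinuousOn (fun L => (weight (chartInv I L) / weight (chartInv K L)) •
        ContinuousLinearMap.id ℂ ℂ) ((lineTriv (n := n) I).baseSet ∩ (lineTriv K).baseSet) :=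
      (((continuousOn_weight_chartInv I).mono Set.inter_subset_left).div
        ((continuousOn_weight_chartInv K).mono Set.inter_subset_right)
        fun L _ => weight_ne_zero _).smul continuousOn_const
    refine this.congr fun L hL => ?_
    ext
    rw [ContinuousLinearEquiv.coe_coe, Trivialization.coordChangeL_apply' _ _ hL]
    change lineCoord L ((lineCoord L).symm (1 * weight (chartInv I L))) / weight (chartInv K L) = _
    simp

/-! ## Čech cocycles -/

theorem continuousAt_of_eventually_eq {X Y : Type*} [TopologicalSpace X] [TopologicalSpace Y]
    {f : X → Y} {x : X} (h : ∀ᶠ y in 𝓝 x, f y = f x) : ContinuousAt f x :=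
  continuousAt_const.congr (h.mono fun _ hy => hy.symm)

theorem eventually_eq_of_continuousAt {X Y : Type*} [TopologicalSpace X] [TopologicalSpace Y]
    [DiscreteTopology Y] {f : X → Y} {x : X} (h : ContinuousAt f x) : ∀ᶠ y in 𝓝 x, f y = f x :=
  h ((isOpen_discrete {f x}).mem_nhds rfl)

section Cocycle

variable {X : Type} [TopologicalSpace X]

/-- The principal `ℤ`-bundle of a cocycle. -/
def Cocycle.torsor (μ : Cocycle X) : FiberBundleCore μ.ι X ℤ where
  baseSet := μ.U
  isOpen_baseSet := μ.isOpen
  indexAt x := (μ.cover x).choose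
  mem_baseSet_at x := (μ.cover x).choose_spec
  coordChange i j x m := m - μ.val i j x
  coordChange_self i x hx m := by rw [μ.val_self i x hx, sub_zero]
  continuousOn_coordChange i j := by
    refine continuousOn_snd.sub ?_
    rintro ⟨x, m⟩ ⟨hx, -⟩
    exact ((continuousAt_of_eventually_eq (μ.locConst i j x hx)).comp
      continuousAt_fst).continuousWithinAt
  coordChange_comp i j k x hx m := by
    have := μ.cocycle i j k x hx
    linarith

/-- The principal ℤ-bundle of the cocycle is a covering space. Over a simply connected, locally path
connected base it has a section, and the coordinates of the section in the local trivializations are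
the primitive. -/
theorem Cocycle.exists_primitive [SimplyConnectedSpace X] [LocallyPathConnectedSpace X]
    (μ : Cocycle X) : ∃ t : μ.ι → X → ℤ,
      (∀ i, ∀ x ∈ μ.U i, ∀ᶠ y in 𝓝 x, t i y = t i x) ∧
      ∀ i j, ∀ x ∈ μ.U i ∩ μ.U j, μ.val i j x = t i x - t j x := by
  have hcov : IsCoveringMap μ.torsor.proj := IsFiberBundle.isCoveringMap fun x =>
    ⟨μ.torsor.localTrivAt x, μ.torsor.mem_localTrivAt_baseSet x⟩
  obtain ⟨x₀⟩ : Nonempty X := inferInstance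
  -- The section is a lift of the identity map.
  obtain ⟨s, ⟨-, hs⟩, -⟩ := hcov.existsUnique_continuousMap_lifts (ContinuousMap.id X) x₀
    (⟨x₀, (0 : ℤ)⟩ : μ.torsor.TotalSpace) rfl
  have hs' : ∀ x, (s x).1 = x := fun x => congrFun hs x
  let e : X → ℤ := fun x => (s x).2
  have happ : ∀ i x, (μ.torsor.localTriv i (s x)).2 = e x - μ.val (μ.torsor.indexAt x) i x :=
    fun i x => by
      change e x - μ.val (μ.torsor.indexAt (s x).1) i (s x).1 = _
      rw [hs' x]
  refine ⟨fun i x => (μ.torsor.localTriv i (s x)).2, fun i x hx => ?_, fun i j x hx => ?_⟩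
  · refine eventually_eq_of_continuousAt (continuousAt_snd.comp ?_)
    refine ContinuousAt.comp ?_ s.continuous.continuousAt
    refine (μ.torsor.localTriv i).continuousAt ?_
    rw [FiberBundleCore.mem_localTriv_source, hs' x]
    exact hx
  · have := μ.cocycle (μ.torsor.indexAt x) i j x ⟨⟨μ.torsor.mem_baseSet_at x, hx.1⟩, hx.2⟩
    beta_reduce
    rw [happ, happ]
    linarith

/-- The pullback of a cocycle. -/
def Cocycle.comap {Y : Type} [TopologicalSpace Y] (μ : Cocycle X) (f : Y → X)
    (hf : Continuous f) : Cocycle Y where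
  ι := μ.ι
  U i := f ⁻¹' μ.U i
  isOpen i := (μ.isOpen i).preimage hf
  cover y := μ.cover (f y)
  val i j y := μ.val i j (f y)
  locConst i j y hy := hf.continuousAt.eventually (μ.locConst i j (f y) hy)
  cocycle i j k y hy := μ.cocycle i j k (f y) hy

theorem Cocycle.Cohomologous.refl (μ : Cocycle X) : μ.Cohomologous μ := by
  refine ⟨μ.val, μ.locConst, fun i j k l x hx => ?_⟩
  have h1 := μ.cocycle i j l x ⟨hx.1, hx.2.2⟩
  have h2 := μ.cocycle i k l x ⟨⟨hx.1.1, hx.2.1⟩, hx.2.2⟩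
  linarith

theorem Cocycle.Cohomologous.symm {μ ν : Cocycle X} (h : μ.Cohomologous ν) :
    ν.Cohomologous μ := by
  obtain ⟨b, hb, h⟩ := h
  refine ⟨fun k i x => -b i k x, fun k i x hx => ?_, fun k l i j x hx => ?_⟩
  · exact (hb i k x hx.symm).mono fun y hy => congrArg Neg.neg hy
  · have := h i j k l x hx.symm
    linarith

theorem Cocycle.Cohomologous.trans {μ ν ρ : Cocycle X} (h : μ.Cohomologous ν)
    (h' : ν.Cohomologous ρ) : μ.Cohomologous ρ := by
  obtain ⟨b, hb, h⟩ := h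
  obtain ⟨c, hc, h'⟩ := h'
  have key : ∀ i k p q x, x ∈ μ.U i → x ∈ ρ.U k → x ∈ ν.U p → x ∈ ν.U q →
      b i p x + c p k x = b i q x + c q k x := by
    intro i k p q x hi hk hp hq
    have h1 := h i i p q x ⟨⟨hi, hi⟩, hp, hq⟩
    have h2 := h' p q k k x ⟨⟨hp, hq⟩, hk, hk⟩
    rw [μ.val_self i x hi] at h1
    rw [ρ.val_self k x hk] at h2
    linarith
  -- The chosen index of ν can vary erratically with x, but by `key` the sum does not depend on it,
  -- so near x one fixed index may be used.
  refine ⟨fun i k x => b i (ν.cover x).choose x + c (ν.cover x).choose k x,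
    fun i k x hx => ?_, fun i j k l x hx => ?_⟩
  · have hp := (ν.cover x).choose_spec
    filter_upwards [hb i _ x ⟨hx.1, hp⟩, hc _ k x ⟨hp, hx.2⟩, (μ.isOpen i).mem_nhds hx.1,
      (ρ.isOpen k).mem_nhds hx.2, (ν.isOpen _).mem_nhds hp] with y h1 h2 h3 h4 h5
    rw [key i k _ _ y h3 h4 (ν.cover y).choose_spec h5, h1, h2]
  · have hp := (ν.cover x).choose_spec
    have h1 := h i j _ _ x ⟨hx.1, hp, hp⟩
    have h2 := h' _ _ k l x ⟨⟨hp, hp⟩, hx.2⟩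
    linarith

theorem Cocycle.Cohomologous.mul {μ ν : Cocycle X} (h : μ.Cohomologous ν) (m : ℤ) :
    (μ.mul m).Cohomologous (ν.mul m) := by
  obtain ⟨b, hb, h⟩ := h
  refine ⟨fun i k x => m * b i k x, fun i k x hx => ?_, fun i j k l x hx => ?_⟩
  · exact (hb i k x hx).mono fun y hy => congrArg (m * ·) hy
  · have := h i j k l x hx
    simp only [Cocycle.mul] at this ⊢
    rw [← mul_sub, this, mul_sub]

theorem Cocycle.mul_mul (μ : Cocycle X) (m k : ℤ) : (μ.mul m).mul k = μ.mul (k * m) := by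
  simp only [Cocycle.mul, mul_assoc]

theorem Cocycle.one_mul (μ : Cocycle X) : μ.mul 1 = μ := by
  simp only [Cocycle.mul, _root_.one_mul]

/-- Two generators differ by a unit of ℤ. Only its parity is kept, as that is all that (-1)^μ sees.
-/
theorem Cocycle.IsGenerator.exists_odd {μ ν : Cocycle X} (hμ : μ.IsGenerator)
    (hν : ν.IsGenerator) : ∃ m : ℤ, Odd m ∧ μ.Cohomologous (ν.mul m) := by
  obtain ⟨m, hm, -⟩ := hν μ
  obtain ⟨k, hk, -⟩ := hμ ν
  have h := hm.trans (hk.mul m)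
  rw [Cocycle.mul_mul] at h
  have h1 : m * k = 1 := (hμ μ).unique h (by rw [Cocycle.one_mul]; exact .refl μ)
  refine ⟨m, ?_, hm⟩
  have : Odd (m * k) := h1 ▸ odd_one
  exact (Int.odd_mul.1 this).1

end Cocycle

/-! ## The space of symmetric matrices -/

theorem convex_symm (n : ℕ) : Convex ℝ {a : Matrix (Fin n) (Fin n) ℝ | a.IsSymm} := by
  intro a ha b hb s t _ _ _
  exact (IsSymm.smul ha s).add (IsSymm.smul hb t)

instance (n : ℕ) : LocallyConvexSpace ℝ (Matrix (Fin n) (Fin n) ℝ) :=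
  inferInstanceAs (LocallyConvexSpace ℝ (Fin n → Fin n → ℝ))

instance (n : ℕ) : LocallyPathConnectedSpace (SymMat n) :=
  (convex_symm n).locallyPathConnectedSpace

instance (n : ℕ) : ContractibleSpace (SymMat n) :=
  (convex_symm n).contractibleSpace ⟨0, isSymm_zero⟩

theorem SymMat.isPreconnected {n : ℕ} {s : Set (Matrix (Fin n) (Fin n) ℝ)} (hs : Convex ℝ s) :
    IsPreconnected {a : SymMat n | a.1 ∈ s} := by
  refine (Topology.IsInducing.subtypeVal 
    (t := {a : Matrix (Fin n) (Fin n) ℝ | a.IsSymm})).isPreconnected_image.1 ?_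
  have : Subtype.val '' {a : SymMat n | a.1 ∈ s} =
      {a : Matrix (Fin n) (Fin n) ℝ | a.IsSymm} ∩ s := by
    ext a
    constructor
    · rintro ⟨a, ha, rfl⟩
      exact ⟨a.2, ha⟩
    · rintro ⟨h1, h2⟩
      exact ⟨⟨a, h1⟩, h2, rfl⟩
  exact this ▸ ((convex_symm n).inter hs).isPreconnected

/-! ### Fourier transforms in one variable -/

/-- The matrix whose only non-zero entry is `s`, at the place `(j, j)`. -/
def single {n : ℕ} (j : Fin n) (s : ℝ) : SymMat n :=
  ⟨Matrix.diagonal (Pi.single j s), isSymm_diagonal _⟩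

theorem block_singleton_det {n : ℕ} (j : Fin n) (a : SymMat n) :
    (block {j} a).det = a.1 j j :=
  det_eq_elem_of_subsingleton _ (⟨j, Finset.mem_singleton_self j⟩ : ({j} : Finset (Fin n)))

theorem blockInv_mul_shiftMat_singleton {n : ℕ} (I : Finset (Fin n)) (a : SymMat n) (i j : Fin n) :
    (blockInv {i} a * shiftMat I {i} a) i j =
      (a.1 i i)⁻¹ * if j = i then dualSign I i else a.1 i j := by
  rw [mul_apply, Finset.sum_eq_single i]
  · congr 1
    · simp only [blockInv, Finset.mem_singleton, and_self, dite_true]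
      rw [inv_subsingleton, diagonal_apply_eq, Ring.inverse_eq_inv']
      rfl
    · by_cases h : j = i
      · subst h; simp [shiftMat]
      · simp [shiftMat, h]
  · intro k _ hk
    simp [blockInv, hk]
  · simp

/-- The diagonal entry of a Schur complement: its sign locates a point in the overlap with the next
adjacent chart. -/
theorem fourierForm_singleton_apply {n : ℕ} (I : Finset (Fin n)) (a : SymMat n) {i j : Fin n}
    (h : j ≠ i) : (fourierForm I {i} a).1 j j = a.1 j j - a.1 i j * (a.1 i i)⁻¹ * a.1 i j := by
  rw [fourierForm_row_notMem a (by simpa using h), Finset.sum_singleton,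
    blockInv_mul_shiftMat_singleton, a.2.apply i j]
  simp [h]
  ring

theorem fourierForm_single {n : ℕ} (I : Finset (Fin n)) (j : Fin n) (s : ℝ) :
    fourierForm I {j} (single j s) = single j (-s⁻¹) := by
  refine Subtype.ext (Matrix.ext fun i k => ?_)
  by_cases hi : i = j
  · subst hi
    rw [fourierForm_row_mem _ (Finset.mem_singleton_self i), blockInv_mul_shiftMat_singleton]
    by_cases hk : k = i
    · subst hk
      have := dualSign_mul_self I k
      simp [single]
      linear_combination s⁻¹ * this
    · simp [single, hk, Ne.symm hk]
  · rw [fourierForm_row_notMem _ (by simpa using hi), Finset.sum_singleton,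
      blockInv_mul_shiftMat_singleton]
    by_cases hk : i = k
    · subst hk
      simp [single, hi, diagonal_apply]
    · simp [single, hi, hk, diagonal_apply]

theorem chart_single {n : ℕ} (I : Finset (Fin n)) (j : Fin n) {s : ℝ} (hs : s ≠ 0) :
    chart (symmDiff I {j}) (single j (-s⁻¹)) = chart I (single j s) := by
  rw [← fourierForm_single I]
  refine chart_fourierForm _ _ _ ?_
  rw [block_singleton_det]
  simpa [single] using hs

/-! ### Lagrangian subspaces in general position -/

/-- The Lagrangian subspaces that belong to all charts. -/
def Generic {n : ℕ} (L : Lag n) : Prop := ∀ I, L ∈ Set.range (chart I)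

/-- In a + ε·1 every block determinant is a nonzero polynomial in ε, so all of them are nonzero for
small ε ≠ 0. -/
theorem frequently_generic {n : ℕ} (L : Lag n) : ∃ᶠ M in 𝓝 L, Generic M := by
  obtain ⟨I, a, rfl⟩ := exists_chart L
  let p : ℝ → SymMat n := fun ε => ⟨a.1 + ε • 1, a.2.add (isSymm_one.smul ε)⟩
  have hp : Continuous p := by
    refine Continuous.subtype_mk (continuous_const.add ?_) _
    exact continuous_id.smul continuous_const
  have hp0 : p 0 = a := Subtype.ext (by simp [p])
  have hdet : ∀ A : Finset (Fin n), ∀ᶠ ε in 𝓝[≠] (0 : ℝ), (block A (p ε)).det ≠ 0 := by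
    intro A
    have hq : (-block A a).charpoly ≠ 0 := (charpoly_monic _).ne_zero
    have he : ∀ ε, (block A (p ε)).det = (-block A a).charpoly.eval ε := by
      intro ε
      rw [eval_charpoly, sub_neg_eq_add, add_comm]
      congr 1
      ext i j
      by_cases hij : i = j
      · subst hij; simp [block, p]
      · simp [block, p, hij, Subtype.coe_injective.ne hij]
    have hfin : ∀ᶠ ε in Filter.cofinite, ε ∉ (-block A a).charpoly.roots.toFinset :=
      (Finset.finite_toSet _).eventually_cofinite_notMem
    filter_upwards [nhdsNE_le_cofinite 0 hfin] with ε hε h0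
    refine hε ?_
    rw [Multiset.mem_toFinset, Polynomial.mem_roots hq, Polynomial.IsRoot, ← he, h0]
  have hall : ∀ᶠ ε in 𝓝[≠] (0 : ℝ), Generic (chart I (p ε)) := by
    filter_upwards [Filter.eventually_all.2 hdet] with ε hε K
    refine ⟨_, (symmDiff_symmDiff_cancel_left I K) ▸ chart_fourierForm I (symmDiff I K) (p ε) (hε _)⟩
  have ht : Filter.Tendsto (fun ε => chart I (p ε)) (𝓝[≠] 0) (𝓝 (chart I a)) := by
    have := ((isOpenEmbedding_chart I).continuous.comp hp).tendsto 0
    rw [Function.comp_apply, hp0] at this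
    exact this.mono_left nhdsWithin_le_nhds
  exact ht.frequently hall.frequently

theorem exists_generic (n : ℕ) : ∃ L : Lag n, Generic L :=
  (frequently_generic (chart ∅ ⟨0, isSymm_zero⟩)).exists

/-! ## Cocycles on the cover by the charts -/

/-- Integer cocycles on the cover of `Λ(n)` by the charts. -/
structure IsChartCocycle {n : ℕ} (δ : Finset (Fin n) → Finset (Fin n) → Lag n → ℤ) : Prop where
  locConst : ∀ I K, ∀ L ∈ Set.range (chart I) ∩ Set.range (chart K), ∀ᶠ M in 𝓝 L, δ I K M = δ I K L
  cocycle : ∀ I K N, ∀ L ∈ Set.range (chart I) ∩ Set.range (chart K) ∩ Set.range (chart N),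
    δ I K L + δ K N L = δ I N L

theorem IsChartCocycle.add_mul {n : ℕ} {δ ε : Finset (Fin n) → Finset (Fin n) → Lag n → ℤ}
    (hδ : IsChartCocycle δ) (hε : IsChartCocycle ε) (m : ℤ) :
    IsChartCocycle fun I K L => δ I K L + m * ε I K L where
  locConst I K L hL := by
    filter_upwards [hδ.locConst I K L hL, hε.locConst I K L hL] with M h1 h2
    rw [h1, h2]
  cocycle I K N L hL := by
    rw [← hδ.cocycle I K N L hL, ← hε.cocycle I K N L hL]
    ring

theorem IsChartCocycle.self {n : ℕ} {δ : Finset (Fin n) → Finset (Fin n) → Lag n → ℤ}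
    (hδ : IsChartCocycle δ) {I : Finset (Fin n)} {L : Lag n} (h : L ∈ Set.range (chart I)) :
    δ I I L = 0 := by
  have := hδ.cocycle I I I L ⟨⟨h, h⟩, h⟩
  linarith

theorem IsChartCocycle.swap {n : ℕ} {δ : Finset (Fin n) → Finset (Fin n) → Lag n → ℤ}
    (hδ : IsChartCocycle δ) {I K : Finset (Fin n)} {L : Lag n} (h : L ∈ Set.range (chart I))
    (h' : L ∈ Set.range (chart K)) : δ K I L = -δ I K L := by
  have := hδ.cocycle I K I L ⟨⟨h, h'⟩, h⟩
  rw [hδ.self h] at this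
  linarith

/-! ### Jumps across the overlaps of adjacent charts -/

/-- The value of a cocycle on the overlap of two adjacent charts, on the component that contains
the matrix `single j s`. -/
def adjVal {n : ℕ} (δ : Finset (Fin n) → Finset (Fin n) → Lag n → ℤ) (I : Finset (Fin n))
    (j : Fin n) (s : ℝ) : ℤ := δ I (symmDiff I {j}) (chart I (single j s))

/-- The jump of a cocycle between the two components of the overlap of two adjacent charts. -/
def jump {n : ℕ} (δ : Finset (Fin n) → Finset (Fin n) → Lag n → ℤ) (I : Finset (Fin n))
    (j : Fin n) : ℤ := adjVal δ I j 1 - adjVal δ I j (-1)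

theorem mem_range_chart_adj {n : ℕ} {I : Finset (Fin n)} {j : Fin n} {a : SymMat n}
    (h : a.1 j j ≠ 0) : chart I a ∈ Set.range (chart (symmDiff I {j})) :=
  ⟨_, chart_fourierForm I {j} a (by rwa [block_singleton_det])⟩

theorem single_apply_self {n : ℕ} (j : Fin n) (s : ℝ) : (single j s).1 j j = s := by
  simp [single]

/-- The overlap with the adjacent chart is a_jj ≠ 0. On a convex set of values of a_jj that avoids 0
the matrices form a connected set, and the locally constant cocycle is constant there. -/
theorem IsChartCocycle.eq_of_convex {n : ℕ} {δ : Finset (Fin n) → Finset (Fin n) → Lag n → ℤ}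
    (hδ : IsChartCocycle δ) {I : Finset (Fin n)} {j : Fin n} {s : Set ℝ} (hs : Convex ℝ s)
    (h0 : ∀ x ∈ s, x ≠ 0) {a b : SymMat n} (ha : a.1 j j ∈ s) (hb : b.1 j j ∈ s) :
    δ I (symmDiff I {j}) (chart I a) = δ I (symmDiff I {j}) (chart I b) := by
  have hc : Convex ℝ {a : Matrix (Fin n) (Fin n) ℝ | a j j ∈ s} :=
    hs.is_linear_preimage (f := fun a : Matrix (Fin n) (Fin n) ℝ => a j j)
      ⟨fun _ _ => rfl, fun _ _ => rfl⟩
  refine (SymMat.isPreconnected hc).constant (f := fun a => δ I (symmDiff I {j}) (chart I a))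
    (fun c hc => ?_) ha hb
  refine ContinuousAt.continuousWithinAt (continuousAt_of_eventually_eq ?_)
  exact (isOpenEmbedding_chart I).continuous.continuousAt.eventually
    (hδ.locConst I _ _ ⟨⟨c, rfl⟩, mem_range_chart_adj (h0 _ hc)⟩)

theorem IsChartCocycle.eq_adjVal {n : ℕ} {δ : Finset (Fin n) → Finset (Fin n) → Lag n → ℤ}
    (hδ : IsChartCocycle δ) {I : Finset (Fin n)} {j : Fin n} {a : SymMat n} {x : ℝ}
    (hx : 0 < x * a.1 j j) : δ I (symmDiff I {j}) (chart I a) = adjVal δ I j x := by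
  rcases pos_and_pos_or_neg_and_neg_of_mul_pos hx with ⟨h1, h2⟩ | ⟨h1, h2⟩
  · exact hδ.eq_of_convex (convex_Ioi 0) (fun _ h => ne_of_gt h) h2
      (by rwa [single_apply_self])
  · exact hδ.eq_of_convex (convex_Iio 0) (fun _ h => ne_of_lt h) h2
      (by rwa [single_apply_self])

/-- The cocycle condition on the intersection of four charts. -/
theorem IsChartCocycle.square {n : ℕ} {δ : Finset (Fin n) → Finset (Fin n) → Lag n → ℤ}
    (hδ : IsChartCocycle δ) (I : Finset (Fin n)) {i j : Fin n} (hij : i ≠ j) (a : SymMat n)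
    {x y x' y' : ℝ} (hx : 0 < x * a.1 i i) (hy : 0 < y * a.1 j j)
    (hx' : 0 < x' * (a.1 i i - a.1 j i * (a.1 j j)⁻¹ * a.1 j i))
    (hy' : 0 < y' * (a.1 j j - a.1 i j * (a.1 i i)⁻¹ * a.1 i j)) :
    adjVal δ I i x + adjVal δ (symmDiff I {i}) j y' =
      adjVal δ I j y + adjVal δ (symmDiff I {j}) i x' := by
  have hi : a.1 i i ≠ 0 := right_ne_zero_of_mul hx.ne'
  have hj : a.1 j j ≠ 0 := right_ne_zero_of_mul hy.ne'
  have ei := chart_fourierForm I {i} a (by rwa [block_singleton_det])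
  have ej := chart_fourierForm I {j} a (by rwa [block_singleton_det])
  rw [← fourierForm_singleton_apply I a hij] at hx'
  rw [← fourierForm_singleton_apply I a hij.symm] at hy'
  have mi := mem_range_chart_adj (I := I) hi
  have mj := mem_range_chart_adj (I := I) hj
  have mij := mem_range_chart_adj (I := symmDiff I {i}) (right_ne_zero_of_mul hy'.ne')
  have mji := mem_range_chart_adj (I := symmDiff I {j}) (right_ne_zero_of_mul hx'.ne')
  rw [ei] at mij
  rw [ej] at mji
  rw [← hδ.eq_adjVal hx, ← hδ.eq_adjVal hy, ← hδ.eq_adjVal hx', ← hδ.eq_adjVal hy', ei, ej,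
    hδ.cocycle _ _ _ _ ⟨⟨⟨a, rfl⟩, mi⟩, mij⟩, hδ.cocycle _ _ _ _ ⟨⟨⟨a, rfl⟩, mj⟩, mji⟩,
    symmDiff_right_comm]

/-- The matrix with the block `(α, γ; γ, β)` at the places `i`, `j`. -/
def twoBlock {n : ℕ} (i j : Fin n) (α β γ : ℝ) : SymMat n :=
  ⟨Matrix.of fun k l => if k = i ∧ l = i then α else if k = j ∧ l = j then β else
    if (k = i ∧ l = j) ∨ (k = j ∧ l = i) then γ else 0, by
    ext k l
    simp only [transpose_apply, Matrix.of_apply, and_comm, or_comm]⟩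

theorem twoBlock_apply {n : ℕ} {i j : Fin n} (hij : i ≠ j) (α β γ : ℝ) :
    (twoBlock i j α β γ).1 i i = α ∧ (twoBlock i j α β γ).1 j j = β ∧
      (twoBlock i j α β γ).1 i j = γ ∧ (twoBlock i j α β γ).1 j i = γ := by
  simp [twoBlock, hij, hij.symm]

theorem IsChartCocycle.jump_adj {n : ℕ} {δ : Finset (Fin n) → Finset (Fin n) → Lag n → ℤ}
    (hδ : IsChartCocycle δ) (I : Finset (Fin n)) {i j : Fin n} (hij : i ≠ j) :
    jump δ (symmDiff I {i}) j = jump δ I j ∧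
      jump δ (symmDiff I {i}) j = jump δ (symmDiff I {j}) i := by
  -- Three sign patterns suffice. From the identity block to diag(1, -1) the signs of a_jj and of
  -- its Schur complement change, which gives the first equality. The block (1, 2; 2, 1) keeps the
  -- diagonal positive while both Schur complements become 1 - 4 = -3, which gives the second.
  have h1 := hδ.square I hij (twoBlock i j 1 1 0) (x := 1) (y := 1) (x' := 1) (y' := 1)
  have h2 := hδ.square I hij (twoBlock i j 1 (-1) 0) (x := 1) (y := -1) (x' := 1) (y' := -1)
  have h3 := hδ.square I hij (twoBlock i j 1 1 2) (x := 1) (y := 1) (x' := -1) (y' := -1)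
  obtain ⟨e1, e2, e3, e4⟩ := twoBlock_apply hij 1 1 0
  rw [e1, e2, e3, e4] at h1
  obtain ⟨e1, e2, e3, e4⟩ := twoBlock_apply hij 1 (-1) 0
  rw [e1, e2, e3, e4] at h2
  obtain ⟨e1, e2, e3, e4⟩ := twoBlock_apply hij 1 1 2
  rw [e1, e2, e3, e4] at h3
  have h1 := h1 (by norm_num) (by norm_num) (by norm_num) (by norm_num)
  have h2 := h2 (by norm_num) (by norm_num) (by norm_num) (by norm_num)
  have h3 := h3 (by norm_num) (by norm_num) (by norm_num) (by norm_num)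
  constructor <;> simp only [jump] <;> linarith

/-- Returning through the same overlap negates the cocycle, and s ↦ -1/s exchanges its two
components; the two signs cancel. -/
theorem IsChartCocycle.jump_self {n : ℕ} {δ : Finset (Fin n) → Finset (Fin n) → Lag n → ℤ}
    (hδ : IsChartCocycle δ) (I : Finset (Fin n)) (j : Fin n) :
    jump δ (symmDiff I {j}) j = jump δ I j := by
  have h : ∀ s : ℝ, s ≠ 0 → adjVal δ (symmDiff I {j}) j (-s⁻¹) = -adjVal δ I j s := by
    intro s hs
    rw [adjVal, adjVal, chart_single I j hs, symmDiff_symmDiff_cancel_right]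
    exact hδ.swap ⟨_, rfl⟩ ⟨_, chart_single I j hs⟩
  have h1 := h 1 one_ne_zero
  have h2 := h (-1) (by norm_num)
  norm_num at h1 h2
  rw [jump, jump, h1, h2]
  ring

theorem IsChartCocycle.jump_eq {n : ℕ} {δ : Finset (Fin n) → Finset (Fin n) → Lag n → ℤ}
    (hδ : IsChartCocycle δ) (I K : Finset (Fin n)) (i j : Fin n) : jump δ I i = jump δ K j := by
  have h1 : ∀ (I : Finset (Fin n)) i j, jump δ (symmDiff I {i}) j = jump δ I j := by
    intro I i j
    by_cases h : i = j
    · subst h; exact hδ.jump_self I i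
    · exact (hδ.jump_adj I h).1
  have h2 : ∀ (I : Finset (Fin n)) j, jump δ I j = jump δ ∅ j := by
    intro I j
    induction I using Finset.induction_on with
    | empty => rfl
    | insert i I hi ih =>
      have : insert i I = symmDiff I {i} := by
        ext k
        by_cases hk : k = i
        · subst hk; simp [Finset.mem_symmDiff, hi]
        · simp [Finset.mem_symmDiff, hk]
      rw [this, h1, ih]
  rw [h2 I, h2 K]
  by_cases h : i = j
  · rw [h]
  · rw [← h1 ∅ j i, ← h1 ∅ i j, (hδ.jump_adj ∅ h).2]

/-- Without jumps the cocycle takes one value on each overlap of adjacent charts. Generic subspaces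
lie in all charts, so a chain of adjacent charts down to ∅ shows that δ I ∅ takes one value on them;
that value is κ I. -/
theorem IsChartCocycle.exists_primitive {n : ℕ}
    {δ : Finset (Fin n) → Finset (Fin n) → Lag n → ℤ} (hδ : IsChartCocycle δ)
    (h0 : ∀ I j, jump δ I j = 0) : ∃ κ : Finset (Fin n) → ℤ, ∀ I K,
      ∀ L ∈ Set.range (chart I) ∩ Set.range (chart K), δ I K L = κ I - κ K := by
  obtain ⟨L₀, hL₀⟩ := exists_generic n
  have hadj : ∀ I j L, Generic L → δ I (symmDiff I {j}) L = adjVal δ I j 1 := by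
    intro I j L hL
    obtain ⟨a, rfl⟩ := hL I
    obtain ⟨b, hb⟩ := hL (symmDiff I {j})
    have h := (chart_eq_iff.1 hb).1
    rw [block_singleton_det] at h
    rcases lt_or_gt_of_ne h with h | h
    · rw [hδ.eq_adjVal (x := -1) (by linarith)]
      have := h0 I j
      rw [jump] at this
      linarith
    · exact hδ.eq_adjVal (by linarith)
  have hbase : ∀ I L, Generic L → δ I ∅ L = δ I ∅ L₀ := by
    intro I L hL
    induction I using Finset.induction_on with
    | empty => rw [hδ.self (hL ∅), hδ.self (hL₀ ∅)]
    | insert j I hj ih =>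
      have h : insert j I = symmDiff I {j} := by
        ext k
        by_cases hk : k = j
        · subst hk; simp [Finset.mem_symmDiff, hj]
        · simp [Finset.mem_symmDiff, hk]
      have h1 := hadj I j L hL
      have h2 := hadj I j L₀ hL₀
      rw [← h] at h1 h2
      rw [← hδ.cocycle _ I ∅ L ⟨⟨hL _, hL _⟩, hL _⟩, ← hδ.cocycle _ I ∅ L₀ ⟨⟨hL₀ _, hL₀ _⟩, hL₀ _⟩,
        hδ.swap (hL I) (hL _), hδ.swap (hL₀ I) (hL₀ _), h1, h2, ih]
  refine ⟨fun I => δ I ∅ L₀, fun I K L hL => ?_⟩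
  -- L need not lie in the chart ∅; a generic M near L does, and the cocycle has the same value
  -- there.
  obtain ⟨M, hM, hM'⟩ := ((frequently_generic L).and_eventually (hδ.locConst I K L hL)).exists
  have := hδ.cocycle I K ∅ M ⟨⟨hM I, hM K⟩, hM ∅⟩
  rw [hbase I M hM, hbase K M hM] at this
  linarith

/-! ## The Maslov cocycle -/

theorem maslovDet_single {n : ℕ} (j : Fin n) (s : ℝ) :
    maslovDet (single j s) = 1 + Complex.I * s := by
  have : (1 + Complex.I • (single j s).1.map ((↑) : ℝ → ℂ)) =
      diagonal fun k => if k = j then 1 + Complex.I * s else 1 := by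
    ext k l
    by_cases hkl : k = l
    · subst hkl
      by_cases hk : k = j
      · subst hk; simp [single]
      · simp [single, hk]
    · simp [single, hkl]
  rw [maslovDet, this, det_diagonal]
  simp

/-- The space of symmetric matrices is simply connected, so the nonvanishing function lifts through
exp. -/
theorem exists_log_maslovDet (n : ℕ) : ∃ g : C(SymMat n, ℂ),
    g ⟨0, isSymm_zero⟩ = 0 ∧ ∀ a, Complex.exp (g a) = maslovDet a := by
  have h0 : maslovDet (⟨0, isSymm_zero⟩ : SymMat n) = 1 := by simp [maslovDet]
  obtain ⟨g, ⟨h1, h2⟩, -⟩ := Complex.isCoveringMapOn_exp.existsUnique_continuousMap_lifts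
    (⟨maslovDet, continuous_maslovDet⟩ : C(SymMat n, ℂ)) (a₀ := ⟨0, isSymm_zero⟩) (e₀ := 0)
    (by rw [Complex.exp_zero]; exact h0.symm) fun a => maslovDet_ne_zero a
  exact ⟨g, h1, fun a => congrFun h2 a⟩

/-- The continuous argument of `det (1 + ia)` that vanishes at `a = 0`. -/
def theta {n : ℕ} (a : SymMat n) : ℝ := ((exists_log_maslovDet n).choose a).im

theorem continuous_theta {n : ℕ} : Continuous (theta (n := n)) :=
  Complex.continuous_im.comp (exists_log_maslovDet n).choose.continuous

theorem maslovDet_eq_exp_theta {n : ℕ} (a : SymMat n) :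
    maslovDet a = ‖maslovDet a‖ * Complex.exp (theta a * Complex.I) := by
  have h := (exists_log_maslovDet n).choose_spec.2 a
  rw [← h, Complex.norm_exp, Complex.ofReal_exp, ← Complex.exp_add, theta, Complex.re_add_im]

theorem theta_single {n : ℕ} (j : Fin n) (s : ℝ) :
    theta (single j s) = (Complex.log (1 + Complex.I * s)).im := by
  obtain ⟨h0, h⟩ := (exists_log_maslovDet n).choose_spec
  have hs : ∀ s : ℝ, 1 + Complex.I * s ∈ Complex.slitPlane := fun s => by
    left; simp
  have hc1 : Continuous fun s : ℝ => (exists_log_maslovDet n).choose (single j s) := by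
    refine (exists_log_maslovDet n).choose.continuous.comp (Continuous.subtype_mk ?_ _)
    have : Continuous fun s : ℝ => (Pi.single j s : Fin n → ℝ) := by
      refine continuous_pi fun k => ?_
      by_cases hk : k = j
      · subst hk; simp only [Pi.single_eq_same]; exact continuous_id
      · simpa [hk] using continuous_const
    exact this.matrix_diagonal
  have hc2 : Continuous fun s : ℝ => Complex.log (1 + Complex.I * s) :=
    (continuous_const.add (continuous_const.mul Complex.continuous_ofReal)).clog hs
  have := Complex.isCoveringMap_exp.eq_of_comp_eq hc1 hc2 (funext fun s => Subtype.ext ?_) 0 ?_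
  · rw [theta, ← congrFun this s]
  · change Complex.exp _ = Complex.exp _
    rw [h, maslovDet_single, Complex.exp_log (Complex.slitPlane_ne_zero (hs s))]
  · have : single j 0 = (⟨0, isSymm_zero⟩ : SymMat n) := Subtype.ext (by simp [single])
    rw [this, h0]
    simp

theorem theta_single_one {n : ℕ} (j : Fin n) : theta (single j 1) = Real.pi / 4 := by
  rw [theta_single, Complex.log_im, Complex.arg_of_re_nonneg (by simp)]
  have : ‖1 + Complex.I * ((1 : ℝ) : ℂ)‖ = √2 := by
    rw [Complex.norm_eq_sqrt_sq_add_sq]; norm_num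
  rw [this, Real.arcsin_eq_iff_eq_sin (by constructor <;> linarith [Real.pi_pos])]
  rw [Real.sin_pi_div_four]
  simp
  field_simp
  norm_num

theorem theta_single_neg_one {n : ℕ} (j : Fin n) : theta (single j (-1)) = -(Real.pi / 4) := by
  have h1 := theta_single_one j
  rw [theta_single, Complex.log_im] at h1 ⊢
  have h2 : 1 + Complex.I * ((-1 : ℝ) : ℂ) = (starRingEnd ℂ) (1 + Complex.I * ((1 : ℝ) : ℂ)) := by
    simp
  rw [h2, Complex.arg_conj, h1, if_neg]
  linarith [Real.pi_pos]

/-- The phase of the frame of `L ⊂ ℂⁿ` given by the coordinates `ŷ_{I,J}`, up to a constant. -/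
def phase {n : ℕ} (I : Finset (Fin n)) (L : Lag n) : ℝ :=
  theta (chartInv I L) - I.card * (Real.pi / 2)

theorem continuousAt_phase {n : ℕ} {I : Finset (Fin n)} {L : Lag n}
    (hL : L ∈ Set.range (chart I)) : ContinuousAt (phase I) L :=
  (continuous_theta.continuousAt.comp ((continuousOn_chartInv I).continuousAt
    ((isOpenEmbedding_chart I).isOpen_range.mem_nhds hL))).sub continuousAt_const

theorem neg_one_pow_card_symmDiff {n : ℕ} (I A : Finset (Fin n)) :
    (-1 : ℂ) ^ (symmDiff I A).card = (-1) ^ I.card * (-1) ^ A.card := by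
  have h : ∀ S : Finset (Fin n), (-1 : ℂ) ^ S.card = ∏ i, if i ∈ S then -1 else 1 := by
    intro S
    rw [Finset.prod_ite_mem, Finset.univ_inter, Finset.prod_const]
  rw [h, h, h, ← Finset.prod_mul_distrib]
  refine Finset.prod_congr rfl fun i _ => ?_
  by_cases h1 : i ∈ I <;> by_cases h2 : i ∈ A <;> simp [Finset.mem_symmDiff, h1, h2]

/-- Squaring `maslovDet_eq` removes the sign of det a_AA: e^{2iθ} changes by (-1)^|A|, and (-1)^|I|
changes by the same factor. Hence exp(2i·phase) depends on L alone, as the squared determinant does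
on U(n)/O(n). -/
theorem exists_phase_sub {n : ℕ} {I K : Finset (Fin n)} {L : Lag n}
    (hI : L ∈ Set.range (chart I)) (hK : L ∈ Set.range (chart K)) :
    ∃ m : ℤ, phase I L - phase K L = m * Real.pi := by
  obtain ⟨a, rfl⟩ := hI
  obtain ⟨A, rfl⟩ : ∃ A, K = symmDiff I A :=
    ⟨symmDiff I K, (symmDiff_symmDiff_cancel_left I K).symm⟩
  obtain ⟨b, hb⟩ := hK
  have hD := maslovDet_eq hb.symm
  have hd := block_det_ne_zero hb.symm
  have hn : ‖maslovDet a‖ = |(block A a).det| * ‖maslovDet b‖ := by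
    rw [hD, norm_mul, norm_mul, norm_pow, Complex.norm_I, one_pow, one_mul,
      Complex.norm_real, Real.norm_eq_abs]
  rw [maslovDet_eq_exp_theta a, maslovDet_eq_exp_theta b, hn] at hD
  have hb0 : (‖maslovDet b‖ : ℂ) ≠ 0 := by exact_mod_cast (norm_pos_iff.2 (maslovDet_ne_zero b)).ne'
  have hd0 : ((block A a).det : ℂ) ≠ 0 := by exact_mod_cast hd
  have hsq : ((|(block A a).det| : ℝ) : ℂ) ^ 2 = ((block A a).det : ℂ) ^ 2 := by
    exact_mod_cast sq_abs (block A a).det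
  have hI : (Complex.I ^ A.card) ^ 2 = (-1) ^ A.card := by
    rw [← pow_mul, mul_comm, pow_mul, Complex.I_sq]
  have key : Complex.exp (theta a * Complex.I) ^ 2 =
      (-1) ^ A.card * Complex.exp (theta b * Complex.I) ^ 2 := by
    refine mul_left_cancel₀ (mul_ne_zero (pow_ne_zero 2 hb0) (pow_ne_zero 2 hd0)) ?_
    push_cast at hD
    have := congrArg (· ^ 2) hD
    simp only [mul_pow, hI] at this
    rw [hsq] at this
    linear_combination this
  have hexp : ∀ S : Finset (Fin n), ∀ t : ℝ,
      Complex.exp (2 * ((t - S.card * (Real.pi / 2) : ℝ) : ℂ) * Complex.I) =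
        Complex.exp (t * Complex.I) ^ 2 * (-1) ^ S.card := by
    intro S t
    have h1 : (-1 : ℂ) ^ S.card = Complex.exp (S.card * (-(Real.pi * Complex.I))) := by
      rw [Complex.exp_nat_mul, Complex.exp_neg, Complex.exp_pi_mul_I]; norm_num
    rw [h1, ← Complex.exp_nat_mul, ← Complex.exp_add]
    congr 1
    push_cast
    ring
  have hone : Complex.exp (2 * ((phase I (chart I a) - phase (symmDiff I A) (chart I a) : ℝ) : ℂ) *
      Complex.I) = 1 := by
    rw [Complex.ofReal_sub, mul_sub, sub_mul, Complex.exp_sub, phase, phase, hexp, hexp,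
      chartInv_chart, ← hb, chartInv_chart, key, neg_one_pow_card_symmDiff]
    have := Complex.exp_ne_zero (theta b * Complex.I)
    have h2 : (-1 : ℂ) ^ A.card ≠ 0 := pow_ne_zero _ (by norm_num)
    have h3 : (-1 : ℂ) ^ I.card ≠ 0 := pow_ne_zero _ (by norm_num)
    field_simp
  obtain ⟨m, hm⟩ := Complex.exp_eq_one_iff.1 hone
  refine ⟨m, ?_⟩
  have h2 : (2 * ((phase I (chart I a) - phase (symmDiff I A) (chart I a) : ℝ) : ℂ)) =
      2 * ((m * Real.pi : ℝ) : ℂ) := by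
    refine mul_right_cancel₀ Complex.I_ne_zero ?_
    rw [hm]
    push_cast
    ring
  exact_mod_cast mul_left_cancel₀ two_ne_zero h2

/-- The Maslov cocycle on the cover by the charts. -/
def maslovIdx {n : ℕ} (I K : Finset (Fin n)) (L : Lag n) : ℤ :=
  round ((phase I L - phase K L) / Real.pi)

theorem maslovIdx_mul_pi {n : ℕ} {I K : Finset (Fin n)} {L : Lag n}
    (hI : L ∈ Set.range (chart I)) (hK : L ∈ Set.range (chart K)) :
    maslovIdx I K L * Real.pi = phase I L - phase K L := by
  obtain ⟨m, hm⟩ := exists_phase_sub hI hK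
  rw [maslovIdx, hm, mul_div_cancel_right₀ _ Real.pi_ne_zero, round_intCast]

theorem isOpen_range_chart {n : ℕ} (I : Finset (Fin n)) : IsOpen (Set.range (chart I)) :=
  (isOpenEmbedding_chart I).isOpen_range

theorem isChartCocycle_maslovIdx (n : ℕ) : IsChartCocycle (maslovIdx (n := n)) where
  locConst I K L hL := by
    have hc : ContinuousAt (fun M => phase I M - phase K M) L :=
      (continuousAt_phase hL.1).sub (continuousAt_phase hL.2)
    filter_upwards [(isOpen_range_chart I).mem_nhds hL.1, (isOpen_range_chart K).mem_nhds hL.2,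
      Metric.continuousAt_iff'.1 hc Real.pi Real.pi_pos] with M h1 h2 h3
    rw [← maslovIdx_mul_pi h1 h2, ← maslovIdx_mul_pi hL.1 hL.2, Real.dist_eq, ← sub_mul, abs_mul,
      abs_of_pos Real.pi_pos] at h3
    -- Integer multiples of π that differ by less than π are equal.
    have h4 : |(maslovIdx I K M - maslovIdx I K L : ℝ)| < 1 := by
      by_contra h
      nlinarith [Real.pi_pos]
    have h5 : |maslovIdx I K M - maslovIdx I K L| < 1 := by exact_mod_cast h4
    exact sub_eq_zero.1 (Int.abs_lt_one_iff.1 h5)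
  cocycle I K N L hL := by
    have h1 := maslovIdx_mul_pi hL.1.1 hL.1.2
    have h2 := maslovIdx_mul_pi hL.1.2 hL.2
    have h3 := maslovIdx_mul_pi hL.1.1 hL.2
    have : ((maslovIdx I K L + maslovIdx K N L : ℤ) : ℝ) = maslovIdx I N L := by
      refine mul_right_cancel₀ Real.pi_ne_zero ?_
      push_cast
      linarith
    exact_mod_cast this

/-- At s = ±1 the transition s ↦ -1/s exchanges the angles π/4 and -π/4, so the phase difference is
±π/2 plus the same constant; the jump is π/π. -/
theorem jump_maslovIdx {n : ℕ} (I : Finset (Fin n)) (j : Fin n) : jump maslovIdx I j = 1 := by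
  have e1 := chart_single I j (s := 1) one_ne_zero
  have e2 := chart_single I j (s := -1) (by norm_num)
  norm_num at e1 e2
  have h1 := maslovIdx_mul_pi (I := I) (K := symmDiff I {j}) (L := chart I (single j 1)) ⟨_, rfl⟩
    ⟨_, e1⟩
  have h2 := maslovIdx_mul_pi (I := I) (K := symmDiff I {j}) (L := chart I (single j (-1)))
    ⟨_, rfl⟩ ⟨_, e2⟩
  have p1 : phase (symmDiff I {j}) (chart I (single j 1)) =
      -(Real.pi / 4) - (symmDiff I {j}).card * (Real.pi / 2) := by
    rw [← e1, phase, chartInv_chart, theta_single_neg_one]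
  have p2 : phase (symmDiff I {j}) (chart I (single j (-1))) =
      Real.pi / 4 - (symmDiff I {j}).card * (Real.pi / 2) := by
    rw [← e2, phase, chartInv_chart, theta_single_one]
  rw [p1, phase, chartInv_chart, theta_single_one] at h1
  rw [p2, phase, chartInv_chart, theta_single_neg_one] at h2
  have : ((jump maslovIdx I j : ℤ) : ℝ) = (1 : ℤ) := by
    refine mul_right_cancel₀ Real.pi_ne_zero ?_
    rw [jump, adjVal, adjVal]
    push_cast
    linarith
  exact_mod_cast this

/-- The Maslov cocycle. -/
def maslov (n : ℕ) : Cocycle (Lag n) where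
  ι := Finset (Fin n)
  U I := Set.range (chart I)
  isOpen := isOpen_range_chart
  cover L := exists_chart L
  val := maslovIdx
  locConst := (isChartCocycle_maslovIdx n).locConst
  cocycle := (isChartCocycle_maslovIdx n).cocycle

/-! ## The first cohomology group of `Λ(n)` -/

/-- Over every chart, a cocycle is a coboundary. -/
theorem exists_primitive_on_charts {n : ℕ} (ν : Cocycle (Lag n)) :
    ∃ t : Finset (Fin n) → ν.ι → Lag n → ℤ,
      (∀ I i, ∀ L ∈ Set.range (chart I) ∩ ν.U i, ∀ᶠ M in 𝓝 L, t I i M = t I i L) ∧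
      ∀ I i j, ∀ L ∈ Set.range (chart I) ∩ (ν.U i ∩ ν.U j), ν.val i j L = t I i L - t I j L := by
  have h := fun I : Finset (Fin n) =>
    (ν.comap (chart I) (isOpenEmbedding_chart I).continuous).exists_primitive
  choose t ht ht' using h
  refine ⟨fun I i L => t I i (chartInv I L), ?_, ?_⟩
  · rintro I i _ ⟨⟨a, rfl⟩, ha⟩
    have hc := (continuousOn_chartInv I).continuousAt ((isOpen_range_chart I).mem_nhds ⟨a, rfl⟩)
    have h := ht I i a ha
    rw [← chartInv_chart I a] at h
    exact hc.eventually h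
  · rintro I i j _ ⟨⟨a, rfl⟩, ha⟩
    beta_reduce
    rw [chartInv_chart]
    exact ht' I i j a ha

/-- On each chart ν has a primitive t_I. The differences t_I - t_K do not depend on the index of the
cover of ν, so they form a chart cocycle, which a multiple of the Maslov cocycle makes free of
jumps. -/
theorem exists_cohomologous_maslov {n : ℕ} (hn : 0 < n) (ν : Cocycle (Lag n)) :
    ∃ m : ℤ, ν.Cohomologous ((maslov n).mul m) := by
  obtain ⟨t, ht, ht'⟩ := exists_primitive_on_charts ν
  let δ : Finset (Fin n) → Finset (Fin n) → Lag n → ℤ := fun I K L =>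
    t I (ν.cover L).choose L - t K (ν.cover L).choose L
  have hδeq : ∀ I K i L, L ∈ Set.range (chart I) → L ∈ Set.range (chart K) → L ∈ ν.U i →
      δ I K L = t I i L - t K i L := by
    intro I K i L hI hK hi
    have h1 := ht' I (ν.cover L).choose i L ⟨hI, (ν.cover L).choose_spec, hi⟩
    have h2 := ht' K (ν.cover L).choose i L ⟨hK, (ν.cover L).choose_spec, hi⟩
    simp only [δ]
    linarith
  have hδ : IsChartCocycle δ := by
    refine ⟨fun I K L hL => ?_, fun I K N L _ => by simp only [δ]; ring⟩
    obtain ⟨i, hi⟩ := ν.cover L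
    filter_upwards [ht I i L ⟨hL.1, hi⟩, ht K i L ⟨hL.2, hi⟩, (ν.isOpen i).mem_nhds hi,
      (isOpen_range_chart I).mem_nhds hL.1, (isOpen_range_chart K).mem_nhds hL.2]
      with M h1 h2 h3 h4 h5
    rw [hδeq I K i M h4 h5 h3, hδeq I K i L hL.1 hL.2 hi, h1, h2]
  let m := -jump δ ∅ ⟨0, hn⟩
  have hε := hδ.add_mul (isChartCocycle_maslovIdx n) m
  obtain ⟨κ, hκ⟩ := hε.exists_primitive fun I j => by
    have h1 := jump_maslovIdx I j
    have h2 := hδ.jump_eq I ∅ j ⟨0, hn⟩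
    simp only [jump, adjVal] at h1 h2 ⊢
    simp only [m, jump, adjVal]
    rw [← h2]
    linear_combination (-(δ I (symmDiff I {j}) (chart I (single j 1)) -
      δ I (symmDiff I {j}) (chart I (single j (-1))))) * h1
  refine ⟨m, fun i I L => t I i L - κ I, fun i I L hL => ?_, fun i j I K L hL => ?_⟩
  · exact (ht I i L hL.symm).mono fun M hM => congrArg (· - κ I) hM
  · obtain ⟨⟨hi, hj⟩, hI, hK⟩ := hL
    have h1 := hκ I K L ⟨hI, hK⟩
    have h2 := hδeq I K j L hI hK hj
    have h3 := ht' I i j L ⟨hI, hi, hj⟩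
    change ν.val i j L - m * maslovIdx I K L = t I i L - κ I - (t K j L - κ K)
    linarith

theorem maslov_isGenerator {n : ℕ} (hn : 0 < n) : (maslov n).IsGenerator := by
  intro ν
  obtain ⟨m, hm⟩ := exists_cohomologous_maslov hn ν
  refine ⟨m, hm, fun k hk => ?_⟩
  -- A cochain bounding (k - m) times the Maslov cocycle is constant on each connected chart, so the
  -- multiple has jump 0; since the Maslov cocycle has jump 1, k = m.
  obtain ⟨b, hb, h⟩ := hk.symm.trans hm
  have hconst : ∀ I : Finset (Fin n), ∀ a a' : SymMat n, b I I (chart I a) = b I I (chart I a') := by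
    intro I a a'
    refine PreconnectedSpace.constant (f := fun a => b I I (chart I a)) inferInstance
      (continuous_iff_continuousAt.2 fun c => continuousAt_of_eventually_eq ?_)
    exact (isOpenEmbedding_chart I).continuous.continuousAt.eventually
      (hb I I _ ⟨⟨c, rfl⟩, ⟨c, rfl⟩⟩)
  have hval : ∀ I K a b', chart K b' = chart I a →
      (k - m) * maslovIdx I K (chart I a) = b I I (chart I a) - b K K (chart K b') := by
    intro I K a b' hab
    have := h I K I K (chart I a) ⟨⟨⟨a, rfl⟩, ⟨b', hab⟩⟩, ⟨a, rfl⟩, ⟨b', hab⟩⟩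
    change k * maslovIdx I K (chart I a) - m * maslovIdx I K (chart I a) = _ at this
    rw [hab, ← this]
    ring
  have h1 := hval ∅ _ _ _ (chart_single ∅ ⟨0, hn⟩ (s := 1) one_ne_zero)
  have h2 := hval ∅ _ _ _ (chart_single ∅ ⟨0, hn⟩ (s := -1) (by norm_num))
  have h3 := jump_maslovIdx (∅ : Finset (Fin n)) ⟨0, hn⟩
  rw [hconst _ _ (single ⟨0, hn⟩ 1), hconst (symmDiff ∅ _) _ (single ⟨0, hn⟩ 1)] at h1 h2
  simp only [jump, adjVal] at h3
  linear_combination h1 - h2 - (k - m) * h3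

/-! ## The bundle of lines and the Maslov class -/

/-- The isomorphism with `(-1)^ν`, in a local frame of the latter bundle and relative to the global
frame of the bundle of lines. Here `b` is a cochain that bounds the difference of the Maslov cocycle
and an odd multiple of `ν`. -/
def signCoord {n : ℕ} {ι : Type} (b : Finset (Fin n) → ι → Lag n → ℤ) (k : ι) (L : Lag n) : ℂ :=
  Complex.exp (-(phase (exists_chart L).choose L * Complex.I)) *
    (-1) ^ b (exists_chart L).choose k L

theorem signCoord_ne_zero {n : ℕ} {ι : Type} (b : Finset (Fin n) → ι → Lag n → ℤ) (k : ι)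
    (L : Lag n) : signCoord b k L ≠ 0 :=
  mul_ne_zero (Complex.exp_ne_zero _) (zpow_ne_zero _ (by norm_num))

section

variable {n : ℕ} {ν : Cocycle (Lag n)} {m : ℤ} {b : Finset (Fin n) → ν.ι → Lag n → ℤ}

/-- A change of chart multiplies exp(-i·phase) by the sign (-1)^`maslovIdx`, and the cochain b
compensates for it, so the arbitrary choice of chart in `signCoord` is immaterial. -/
theorem signCoord_eq
    (h : ∀ I K k l, ∀ L ∈ Set.range (chart I) ∩ Set.range (chart K) ∩ (ν.U k ∩ ν.U l),
      maslovIdx I K L - m * ν.val k l L = b I k L - b K l L)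
    {I : Finset (Fin n)} {k : ν.ι} {L : Lag n} (hI : L ∈ Set.range (chart I)) (hk : L ∈ ν.U k) :
    signCoord b k L = Complex.exp (-(phase I L * Complex.I)) * (-1) ^ b I k L := by
  have hK : L ∈ Set.range (chart (exists_chart L).choose) := (exists_chart L).choose_spec
  rw [signCoord]
  generalize (exists_chart L).choose = K at hK
  have h1 := h I K k k L ⟨⟨hI, hK⟩, hk, hk⟩
  rw [ν.val_self k L hk, mul_zero, sub_zero] at h1
  have h2 := maslovIdx_mul_pi hI hK
  have h3 : Complex.exp (-(phase K L * Complex.I)) =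
      Complex.exp (-(phase I L * Complex.I)) * (-1) ^ (b I k L - b K k L) := by
    rw [← h1, ← Complex.exp_pi_mul_I, ← Complex.exp_int_mul, ← Complex.exp_add]
    congr 1
    have : (maslovIdx I K L : ℂ) * Real.pi = phase I L - phase K L := by exact_mod_cast h2
    linear_combination (-Complex.I) * this
  rw [h3, mul_assoc, ← zpow_add₀ (by norm_num), sub_add_cancel]

/-- In one chart the Maslov cocycle vanishes, so b changes by m·ν. As m is odd, the sign is that of
ν itself. -/
theorem signCoord_change (hm : Odd m)
    (h : ∀ I K k l, ∀ L ∈ Set.range (chart I) ∩ Set.range (chart K) ∩ (ν.U k ∩ ν.U l),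
      maslovIdx I K L - m * ν.val k l L = b I k L - b K l L)
    {k l : ν.ι} {L : Lag n} (hk : L ∈ ν.U k) (hl : L ∈ ν.U l) :
    signCoord b l L = (-1) ^ ν.val k l L * signCoord b k L := by
  obtain ⟨I, hI⟩ := exists_chart L
  have h1 := h I I k l L ⟨⟨hI, hI⟩, hk, hl⟩
  rw [(isChartCocycle_maslovIdx n).self hI] at h1
  have h2 : ((-1 : ℂ)) ^ ν.val k l L = (-1) ^ (m * ν.val k l L) := by
    rw [_root_.zpow_mul, hm.neg_one_zpow]
  rw [signCoord_eq h hI hk, signCoord_eq h hI hl, h2, mul_left_comm, ← zpow_add₀ (by norm_num)]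
  congr 2
  linarith

theorem continuousOn_signCoord
    (hb : ∀ I k, ∀ L ∈ Set.range (chart I) ∩ ν.U k, ∀ᶠ M in 𝓝 L, b I k M = b I k L)
    (h : ∀ I K k l, ∀ L ∈ Set.range (chart I) ∩ Set.range (chart K) ∩ (ν.U k ∩ ν.U l),
      maslovIdx I K L - m * ν.val k l L = b I k L - b K l L) (k : ν.ι) :
    ContinuousOn (signCoord b k) (ν.U k) := by
  intro L hk
  obtain ⟨I, hI⟩ := exists_chart L
  have hc : ContinuousAt (fun M => Complex.exp (-(phase I M * Complex.I)) * (-1 : ℂ) ^ b I k L) L :=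
    (((Complex.continuous_ofReal.continuousAt.comp (continuousAt_phase hI)).mul
      continuousAt_const).neg.cexp).mul continuousAt_const
  refine (hc.congr ?_).continuousWithinAt
  filter_upwards [(isOpen_range_chart I).mem_nhds hI, (ν.isOpen k).mem_nhds hk,
    hb I k L ⟨hI, hk⟩] with M h1 h2 h3
  rw [signCoord_eq h h1 h2, h3]

/-- The isomorphism of the bundle of lines with the bundle `(-1)^ν`. -/
def signIso (b : Finset (Fin n) → ν.ι → Lag n → ℤ) (L : Lag n) :
    Line n L ≃ₗ[ℂ] ν.signBundle.Fiber L :=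
  (lineCoord L).trans
    (LinearEquiv.smulOfNeZero ℂ ℂ _ (signCoord_ne_zero b (ν.signBundle.indexAt L) L))

theorem localTriv_signIso (hm : Odd m)
    (h : ∀ I K k l, ∀ L ∈ Set.range (chart I) ∩ Set.range (chart K) ∩ (ν.U k ∩ ν.U l),
      maslovIdx I K L - m * ν.val k l L = b I k L - b K l L)
    {k : ν.ι} {L : Lag n} (hk : L ∈ ν.U k) (v : Line n L) :
    (ν.signBundle.localTriv k ⟨L, signIso b L v⟩).2 = signCoord b k L * lineCoord L v := by
  rw [VectorBundleCore.localTriv_apply,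
    signCoord_change hm h (ν.signBundle.mem_baseSet_at L) hk, mul_assoc]
  rfl

/-- The map of total spaces given by `signIso`. -/
def signTotal (b : Finset (Fin n) → ν.ι → Lag n → ℤ) :
    TotalSpace ℂ (Line n) ≃ TotalSpace ℂ ν.signBundle.Fiber where
  toFun v := ⟨v.1, signIso b v.1 v.2⟩
  invFun w := ⟨w.1, (signIso b w.1).symm w.2⟩
  left_inv v := by simp
  right_inv w := by simp

theorem continuous_signTotal (hm : Odd m)
    (hb : ∀ I k, ∀ L ∈ Set.range (chart I) ∩ ν.U k, ∀ᶠ M in 𝓝 L, b I k M = b I k L)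
    (h : ∀ I K k l, ∀ L ∈ Set.range (chart I) ∩ Set.range (chart K) ∩ (ν.U k ∩ ν.U l),
      maslovIdx I K L - m * ν.val k l L = b I k L - b K l L) :
    Continuous (signTotal b) := by
  have h1 : Continuous fun v : TotalSpace ℂ (Line n) => v.1 :=
    continuous_fst.comp (totalHomeomorph n).continuous
  have h2 : Continuous fun v : TotalSpace ℂ (Line n) => lineCoord v.1 v.2 :=
    continuous_snd.comp (totalHomeomorph n).continuous
  refine continuous_iff_continuousAt.2 fun v => ?_
  obtain ⟨k, hk⟩ := ν.cover v.1
  have hU : ∀ᶠ w in 𝓝 v, w.1 ∈ ν.U k := h1.continuousAt.eventually ((ν.isOpen k).mem_nhds hk)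
  refine ((ν.signBundle.localTriv k).tendsto_nhds_iff
    ((ν.signBundle.mem_localTriv_source k (signTotal b v)).2 hk)).2 ⟨h1.continuousAt, ?_⟩
  have hc := (((continuousOn_signCoord hb h k).continuousAt ((ν.isOpen k).mem_nhds hk)).comp
    (f := fun v : TotalSpace ℂ (Line n) => v.1) h1.continuousAt).mul h2.continuousAt
  have := hc.congr (f := _) (g := fun w => (ν.signBundle.localTriv k (signTotal b w)).2)
    (hU.mono fun w hw => (localTriv_signIso hm h hw w.2).symm)
  exact this

theorem continuous_signTotal_symm (hm : Odd m)
    (hb : ∀ I k, ∀ L ∈ Set.range (chart I) ∩ ν.U k, ∀ᶠ M in 𝓝 L, b I k M = b I k L)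
    (h : ∀ I K k l, ∀ L ∈ Set.range (chart I) ∩ Set.range (chart K) ∩ (ν.U k ∩ ν.U l),
      maslovIdx I K L - m * ν.val k l L = b I k L - b K l L) :
    Continuous (signTotal b).symm := by
  refine continuous_iff_continuousAt.2 fun w => ?_
  have h1 : Continuous fun w : TotalSpace ℂ ν.signBundle.Fiber => w.1 :=
    FiberBundle.continuous_proj ℂ ν.signBundle.Fiber
  obtain ⟨k, hk⟩ := ν.cover w.1
  have hU : ∀ᶠ w' in 𝓝 w, w'.1 ∈ ν.U k := h1.continuousAt.eventually ((ν.isOpen k).mem_nhds hk)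
  have h2 : ContinuousAt (fun w' => (ν.signBundle.localTriv k w').2) w :=
    continuousAt_snd.comp ((ν.signBundle.localTriv k).continuousAt
      ((ν.signBundle.mem_localTriv_source k _).2 hk))
  have hc := h2.div (((continuousOn_signCoord hb h k).continuousAt
    ((ν.isOpen k).mem_nhds hk)).comp (f := fun w : TotalSpace ℂ ν.signBundle.Fiber => w.1)
    h1.continuousAt) (signCoord_ne_zero b k w.1)
  have hc' := (totalHomeomorph n).symm.continuous.continuousAt.comp (h1.continuousAt.prodMk hc)
  refine hc'.congr (hU.mono fun w' hw' => ?_)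
  obtain ⟨v, rfl⟩ := (signTotal b).surjective w'
  rw [Equiv.symm_apply_apply]
  change (totalHomeomorph n).symm (v.1, (ν.signBundle.localTriv k ⟨v.1, signIso b v.1 v.2⟩).2 /
    signCoord b k v.1) = v
  rw [localTriv_signIso hm h (show v.1 ∈ ν.U k from hw'), mul_div_cancel_left₀ _ (signCoord_ne_zero b k v.1)]
  exact (totalHomeomorph n).symm_apply_apply v

/-! ### Phases of the sections 1_{I,J} -/

theorem weight_eq {n : ℕ} (a : SymMat n) :
    weight a = Complex.exp (theta a * Complex.I) * (1 / Real.sqrt ‖maslovDet a‖ : ℝ) := by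
  have h0 := norm_pos_iff.2 (maslovDet_ne_zero a)
  have h1 : (‖maslovDet a‖ : ℂ) ≠ 0 := by exact_mod_cast h0.ne'
  have h2 : (Real.sqrt ‖maslovDet a‖ : ℂ) ≠ 0 := by exact_mod_cast (Real.sqrt_pos.2 h0).ne'
  rw [weight]
  conv_lhs => enter [1]; rw [maslovDet_eq_exp_theta]
  push_cast
  field_simp

/-- The angle θ of the weight cancels against exp(-i·phase). What is left is a positive modulus
times a constant depending on I and a locally constant sign. -/
theorem localTriv_signIso_frame (hm : Odd m)
    (h : ∀ I K k l, ∀ L ∈ Set.range (chart I) ∩ Set.range (chart K) ∩ (ν.U k ∩ ν.U l),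
      maslovIdx I K L - m * ν.val k l L = b I k L - b K l L)
    {I : Finset (Fin n)} {k : ν.ι} {a : SymMat n} (hk : chart I a ∈ ν.U k) :
    (ν.signBundle.localTriv k ⟨chart I a, signIso b (chart I a) (frame I a)⟩).2 =
      (1 / Real.sqrt ‖maslovDet a‖ : ℝ) *
        (Complex.exp (I.card * (Real.pi / 2) * Complex.I) * (-1) ^ b I k (chart I a)) := by
  rw [localTriv_signIso hm h hk, signCoord_eq h ⟨a, rfl⟩ hk, lineCoord_frame, weight_eq]
  have : Complex.exp (I.card * (Real.pi / 2) * Complex.I) =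
      Complex.exp (-(phase I (chart I a) * Complex.I)) * Complex.exp (theta a * Complex.I) := by
    rw [← Complex.exp_add, phase, chartInv_chart]
    congr 1
    push_cast
    ring
  rw [this]
  ring

end

end WeilBundle

end

/-! ### Assembly of the theorem -/

theorem mainTheorem7 (n : ℕ) (hn : 0 < n) :
    (∀ (I : Finset (Fin n)) (a : SymMat n),
      Function.Injective (incl I a) ∧
      LinearMap.range (incl I a) = fiber (chart I a) ∧
      lineAt (chart I a) = (ℂ ∙ Coef.one n).map (incl I a)) ∧
    (∃ _ : FiberBundle ℂ (Line n), VectorBundle ℂ ℂ (Line n) ∧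
      ∀ I : Finset (Fin n), ∃ e ∈ FiberBundle.trivializationAtlas ℂ (Line n),
        e.baseSet = Set.range (chart I) ∧
        ∀ a : SymMat n, e ⟨chart I a, frame I a⟩ = (chart I a, 1)) ∧
    (∃ μ : Cocycle (Lag n), μ.IsGenerator) ∧
    ∀ μ : Cocycle (Lag n), μ.IsGenerator →
      ∃ φ : ∀ L : Lag n, Line n L ≃ₗ[ℂ] μ.signBundle.Fiber L,
        IsHomeomorph (fun v : TotalSpace ℂ (Line n) =>
          (⟨v.1, φ v.1 v.2⟩ : TotalSpace ℂ μ.signBundle.Fiber)) ∧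
        ∀ (I : Finset (Fin n)) (j : μ.ι) (a : SymMat n), chart I a ∈ μ.U j →
          ∀ᶠ b in 𝓝 a, ∃ r : ℝ, 0 < r ∧
            (μ.signBundle.localTriv j ⟨chart I b, φ (chart I b) (frame I b)⟩).2 =
              (r : ℂ) * (μ.signBundle.localTriv j ⟨chart I a, φ (chart I a) (frame I a)⟩).2 := by
  refine ⟨fun I a => ⟨incl_injective I a, range_incl I a, ?_⟩,
    ⟨lineFiberBundle n, lineVectorBundle n, fun I => ⟨lineTriv I, ⟨I, rfl⟩, rfl, fun a => ?_⟩⟩,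
    ⟨maslov n, maslov_isGenerator hn⟩, fun μ hμ => ?_⟩
  · rw [lineAt_chart, Submodule.map_span, Set.image_singleton]
    rfl
  · rw [lineTriv_apply, lineCoord_frame, chartInv_chart, div_self (weight_ne_zero a)]
  · obtain ⟨m, hm, b, hb, h⟩ : ∃ m : ℤ, Odd m ∧ ∃ b : Finset (Fin n) → μ.ι → Lag n → ℤ,
        (∀ I k, ∀ L ∈ Set.range (chart I) ∩ μ.U k, ∀ᶠ M in 𝓝 L, b I k M = b I k L) ∧
        ∀ I K k l, ∀ L ∈ Set.range (chart I) ∩ Set.range (chart K) ∩ (μ.U k ∩ μ.U l),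
          maslovIdx I K L - m * μ.val k l L = b I k L - b K l L :=
      (maslov_isGenerator hn).exists_odd hμ
    refine ⟨signIso b, ?_, fun I j a ha => ?_⟩
    · let e : TotalSpace ℂ (Line n) ≃ₜ TotalSpace ℂ μ.signBundle.Fiber :=
        { signTotal b with
          continuous_toFun := continuous_signTotal hm hb h
          continuous_invFun := continuous_signTotal_symm hm hb h }
      exact e.isHomeomorph
    · have hc := (isOpenEmbedding_chart I).continuous.continuousAt (x := a)
      filter_upwards [hc.eventually ((μ.isOpen j).mem_nhds ha),
        hc.eventually (hb I j _ ⟨⟨a, rfl⟩, ha⟩)] with c h1 h2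
      have ha0 := Real.sqrt_pos.2 (norm_pos_iff.2 (maslovDet_ne_zero a))
      have hc0 := Real.sqrt_pos.2 (norm_pos_iff.2 (maslovDet_ne_zero c))
      -- The phases agree once b I j is constant near the point, so r is the quotient of the moduli
      -- 1/√|D|.
      refine ⟨Real.sqrt ‖maslovDet a‖ / Real.sqrt ‖maslovDet c‖, div_pos ha0 hc0, ?_⟩
      have key : 1 / Real.sqrt ‖maslovDet c‖ = Real.sqrt ‖maslovDet a‖ / Real.sqrt ‖maslovDet c‖ *
          (1 / Real.sqrt ‖maslovDet a‖) := by
        field_simp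
      rw [localTriv_signIso_frame hm h h1, localTriv_signIso_frame hm h ha, h2, key,
        Complex.ofReal_mul]
      exact mul_assoc _ _ _
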